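/- Let $1<p<\infty$, let $i,m$ be integers with $1\le i<m$, let $T_*\in(0,1)$ with $T_*\neq i/m$, and let $q_0$ be a constant. For $q\in L^p([0,1],\mathbb R)$ let $\lambda_1(q)<\lambda_2(q)<\cdots$ be the Dirichlet eigenvalues of $-y''+qy$ on $[0,1]$, let $E_m(\cdot;q)$ be an eigenfunction for $\lambda_m(q)$, and let $T_{i,m}(q)$ be the $i$-th zero of $E_m(\cdot;q)$ in $(0,1)$. Let $\hat q\in L^p$ minimize $\|q-q_0\|_{L^p}$ among all $q\in L^p$ with $T_{i,m}(q)=T_*$. Write $E=E_m(\cdot;\hat q)$ (any normalization), $\lambda_m=\lambda_m(\hat q)$, $p^*=p/(p-1)$, $\phi_r(s)=|s|^{r-2}s$, and $$a=\int_{T_*}^1\Big(\frac{E(v)}{E'(T_*)}\Big)^2dv,\qquad b=\int_0^{T_*}\Big(\frac{E(v)}{E'(T_*)}\Big)^2dv,\qquad H=\begin{cases}a&\text{on }[0,T_*],\\-b&\text{on }(T_*,1].\end{cases}$$ Then there is exactly one $c\in\mathbb R$ with $$\|\hat q-q_0\|_{L^p}^{1-p}\,\phi_p(\hat q-q_0)=c\,H\,E^2\quad\text{a.e.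 on }[0,1],$$ and $c\ne0$. Put $\varepsilon=\operatorname{sign}(c)$, $\hat a=\|\hat q-q_0\|_{L^p}^{p-1}ac$, $\hat b=\|\hat q-q_0\|_{L^p}^{p-1}bc$, and let $u_m=\sqrt{|\hat a|}\,E$ on $[0,T_*]$, $u_m=\sqrt{|\hat b|}\,E$ on $(T_*,1]$. Then $\hat q-q_0=\varepsilon|u_m|^{2p^*-2}$ a.e. on $[0,T_*]$, $\hat q-q_0=-\varepsilon|u_m|^{2p^*-2}$ a.e. on $(T_*,1]$, and $u_m$ satisfies the critical equation $$\begin{cases}-u_m''+q_0u_m+\varepsilon\,\phi_{2p^*}(u_m)=\lambda_mu_m&\text{on }[0,T_*],\\-u_m''+q_0u_m-\varepsilon\,\phi_{2p^*}(u_m)=\lambda_mu_m&\text{on }[T_*,1],\end{cases}$$ classically on each of the two intervals, with one-sided derivatives at their endpoints. Moreover, the sign $\varepsilon$ in the critical equation is determined by $T_*$: $$\varepsilon=\begin{cases}-1,&\text{if }0<T_*<\frac im,\\+1,&\text{if }\frac im<T_*<1.\end{cases}$$ -/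

import Mathlib

open MeasureTheory Set

noncomputable section

namespace InverseNodal

/-- Lebesgue measure on the unit interval `[0, 1]`. -/
def unitMeasure : Measure ℝ := volume.restrict (Icc (0 : ℝ) 1)

/-- `y` is a (Carathéodory) solution of `-y'' + q y = μ y` on `[0, 1]`: it is differentiable on
`[0, 1]` with an absolutely continuous derivative `z`, and `z' = (q - μ) y` almost everywhere.
The values outside `[0, 1]` are irrelevant. -/
def IsSolution (q : ℝ → ℝ) (μ : ℝ) (y : ℝ → ℝ) : Prop :=
  ∃ z : ℝ → ℝ,
    (∀ x ∈ Icc (0 : ℝ) 1, HasDerivWithinAt y (z x) (Icc 0 1) x) ∧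
    AbsolutelyContinuousOnInterval z 0 1 ∧
    ∀ᵐ x ∂unitMeasure, HasDerivAt z ((q x - μ) * y x) x

/-- `y` is a Dirichlet eigenfunction of `-y'' + q y` on `[0, 1]` for the eigenvalue `μ`. -/
def IsEigenfunction (q : ℝ → ℝ) (μ : ℝ) (y : ℝ → ℝ) : Prop :=
  IsSolution q μ y ∧ y 0 = 0 ∧ y 1 = 0 ∧ ∃ x ∈ Icc (0 : ℝ) 1, y x ≠ 0

/-- `μ` is a Dirichlet eigenvalue of `-y'' + q y` on `[0, 1]`. -/
def IsEigenvalue (q : ℝ → ℝ) (μ : ℝ) : Prop := ∃ y, IsEigenfunction q μ y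

/-- `μ = λ_m(q)`: `μ` is the `m`-th Dirichlet eigenvalue in increasing order, `m = 1, 2, …`. -/
def IsNthEigenvalue (q : ℝ → ℝ) (m : ℕ) (μ : ℝ) : Prop :=
  IsEigenvalue q μ ∧ {ν : ℝ | IsEigenvalue q ν ∧ ν < μ}.encard + 1 = (m : ℕ∞)

/-- `(μ, E)` is an `m`-th eigenpair: `μ = λ_m(q)` and `E = E_m(·; q)` is an eigenfunction for it
(of any normalization). -/
def IsNthEigenpair (q : ℝ → ℝ) (m : ℕ) (μ : ℝ) (E : ℝ → ℝ) : Prop :=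
  IsNthEigenvalue q m μ ∧ IsEigenfunction q μ E

/-- `T_{i,m}(q) = T`: the number `T` is the `i`-th zero in `(0, 1)`, in increasing order, of an
eigenfunction for the `m`-th eigenvalue. -/
def IsNode (q : ℝ → ℝ) (i m : ℕ) (T : ℝ) : Prop :=
  ∃ μ E, IsNthEigenpair q m μ E ∧ T ∈ Ioo (0 : ℝ) 1 ∧ E T = 0 ∧
    {x : ℝ | x ∈ Ioo (0 : ℝ) 1 ∧ E x = 0 ∧ x < T}.encard + 1 = (i : ℕ∞)

/-- The norm of `L^p([0, 1], ℝ)`. -/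
def lpNorm (p : ℝ) (f : ℝ → ℝ) : ℝ := (eLpNorm f (ENNReal.ofReal p) unitMeasure).toReal

/-- `q` solves the inverse nodal problem: it minimizes the distance to `q₀` in `L^p` among the
potentials whose `(i, m)`-th node is `T`. -/
def IsOptimalPotential (p : ℝ) (i m : ℕ) (T : ℝ) (q₀ q : ℝ → ℝ) : Prop :=
  MemLp q (ENNReal.ofReal p) unitMeasure ∧ IsNode q i m T ∧
    ∀ r : ℝ → ℝ, MemLp r (ENNReal.ofReal p) unitMeasure → IsNode r i m T →
      lpNorm p (fun x => q x - q₀ x) ≤ lpNorm p (fun x => r x - q₀ x)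

/-- The homeomorphism `φ_r(s) = |s|^{r-2} s`. -/
def phi (r s : ℝ) : ℝ := |s| ^ (r - 2) * s

/-- `a = ∫_T^1 (E / E'(T))²`. -/
def coeffA (T : ℝ) (E : ℝ → ℝ) : ℝ := ∫ v in T..1, (E v / deriv E T) ^ 2

/-- `b = ∫_0^T (E / E'(T))²`. -/
def coeffB (T : ℝ) (E : ℝ → ℝ) : ℝ := ∫ v in (0 : ℝ)..T, (E v / deriv E T) ^ 2

/-- The step function `H`, equal to `a` on `[0, T]` and to `-b` on `(T, 1]`. -/
def stepH (T : ℝ) (E : ℝ → ℝ) (x : ℝ) : ℝ := if x ≤ T then coeffA T E else -coeffB T E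

/-- `c` is a Lagrange multiplier for `q`:
`‖q - q₀‖^{1-p} φ_p(q - q₀) = c H E²` almost everywhere on `[0, 1]`. -/
def IsMultiplier (p T : ℝ) (q₀ q E : ℝ → ℝ) (c : ℝ) : Prop :=
  ∀ᵐ x ∂unitMeasure,
    lpNorm p (fun t => q t - q₀ t) ^ (1 - p) * phi p (q x - q₀ x) = c * stepH T E x * E x ^ 2

/-- The piecewise rescaled eigenfunction `u`, equal to `√|â| E` on `[0, T]` and to `√|b̂| E` on
`(T, 1]`, where `â = ‖q - q₀‖^{p-1} a c` and `b̂ = ‖q - q₀‖^{p-1} b c`. -/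
def scaledEigenfunction (p T : ℝ) (q₀ q E : ℝ → ℝ) (c x : ℝ) : ℝ :=
  if x ≤ T then √|lpNorm p (fun t => q t - q₀ t) ^ (p - 1) * coeffA T E * c| * E x
  else √|lpNorm p (fun t => q t - q₀ t) ^ (p - 1) * coeffB T E * c| * E x

/-- `q - q₀ = ε |u|^{2p*-2}` on `[0, T]` and `q - q₀ = -ε |u|^{2p*-2}` on `(T, 1]`, almost
everywhere, with `p* = p / (p - 1)`. -/
def CriticalPotential (p T : ℝ) (q₀ q : ℝ → ℝ) (ε : ℝ) (u : ℝ → ℝ) : Prop :=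
  ∀ᵐ x ∂unitMeasure,
    q x - q₀ x = (if x ≤ T then ε else -ε) * |u x| ^ (2 * (p / (p - 1)) - 2)

/-- `u` is a classical (twice differentiable) solution on `[a, b]` of
`-u'' + q₀ u + σ φ_{2p*}(u) = μ u`, with one-sided derivatives at `a` and `b`. -/
def SolvesOn (p a b : ℝ) (q₀ : ℝ → ℝ) (μ σ : ℝ) (u : ℝ → ℝ) : Prop :=
  ∃ v w : ℝ → ℝ, ∀ x ∈ Icc a b,
    HasDerivWithinAt u (v x) (Icc a b) x ∧ HasDerivWithinAt v (w x) (Icc a b) x ∧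
      -w x + q₀ x * u x + σ * phi (2 * (p / (p - 1))) (u x) = μ * u x

/-- The critical equation with sign `ε`: coefficient `ε` on `[0, T]`, and `-ε` on `[T, 1]`. -/
def CriticalEquation (p T : ℝ) (q₀ : ℝ → ℝ) (μ ε : ℝ) (u : ℝ → ℝ) : Prop :=
  SolvesOn p 0 T q₀ μ ε u ∧ SolvesOn p T 1 q₀ μ (-ε) u

end InverseNodal

end

noncomputable section

namespace InverseNodal

/-! Only integrability of the potential is available, so the equation is rewritten for `y` and the
quasi-derivative `u = y' - Q y`, with `Q` a primitive of `q`. The system for `(y, u)` has continuous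
coefficients, and so does the equation of its Prüfer angle `θ`. Since `θ' = 1` whenever `sin θ = 0`,
zeros of the solution correspond to the values `kπ` of `θ`. Since `θ 1` increases strictly and
continuously with the spectral parameter, the node condition becomes `θ T = iπ` and `θ 1 = mπ` at `μ
= λ_m` (`isNthEigenvalue_iff`, `IsNode.pruferAngle_eq`).

The multiplier rule is obtained without differentiating the node as a function of the potential. If
`h` is continuous, orthogonal to `E²` on `[0, T]` and on `[T, 1]`, and supported where `|E|` is
bounded below, then `w'' = (q - μ) w + h E` has a solution vanishing at `0`, `T` and `1`
(`IsEigenfunction.exists_linearization`). The function `E + s w` is then an exact eigenfunction, for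
the same `μ`, of `q + s g` with `g = h E / (E + s w)`, and for small `s` the node index cannot jump
(`IsEigenfunction.exists_perturbation`). Minimality along this family, for `h` and `-h`, gives `∫
φ_p(q - κ) h = 0`. Hence `φ_p(q - κ)` is `k₀ E²` to the left of `T` and `k₁ E²` to the right.
Constants are also admissible directions, as they shift the spectrum and fix the nodes; they give
`k₀ ∫_0^T E² = -k₁ ∫_T^1 E²`, which says that `(k₀, k₁)` is proportional to `(a, -b)`
(`IsOptimalPotential.exists_multipliers`). Inverting `φ_p` and inserting the result into the
equation of `E` gives the critical equation.

For the sign, `q - κ` has the sign `ε` on the left and `-ε` on the right. Sturm comparison with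
sines compares `μ - κ` with `(iπ/T)²` and with `((m-i)π/(1-T))²` in opposite directions, so `ε = 1`
forces `T ≥ i/m` and `ε = -1` forces `T ≤ i/m`. Applied to `q = κ`, both bounds give `T = i/m`; this
is why the multiplier is nonzero. -/

/-- The primitive of `q` vanishing at `0`. -/
def primitive (q : ℝ → ℝ) (x : ℝ) : ℝ := ∫ t in (0 : ℝ)..x, q t

/-- The first order system equivalent to `-y'' + Q' y = μ y`, with quasi-derivative
`u = y' - Q y`; its coefficients only involve `Q`. -/
def IsRegularized (Q : ℝ → ℝ) (μ : ℝ) (y u : ℝ → ℝ) : Prop :=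
  ∀ x ∈ Icc (0 : ℝ) 1, HasDerivWithinAt y (u x + Q x * y x) (Icc 0 1) x ∧
    HasDerivWithinAt u (-(Q x * u x) - (Q x ^ 2 + μ) * y x) (Icc 0 1) x

/-- The right-hand side of the Prüfer equation of the regularized system. -/
def pruferField (Q : ℝ → ℝ) (μ x t : ℝ) : ℝ :=
  (Real.cos t + Q x * Real.sin t) ^ 2 + μ * Real.sin t ^ 2

/-- `θ` is a Prüfer angle on `[0, 1]`. -/
def IsPruferAngle (Q : ℝ → ℝ) (μ : ℝ) (θ : ℝ → ℝ) : Prop :=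
  ∀ x ∈ Icc (0 : ℝ) 1, HasDerivWithinAt θ (pruferField Q μ x (θ x)) (Icc 0 1) x

/-! ### Calculus of absolutely continuous functions on an interval -/

lemma hasDerivWithinAt_integral_of_continuousOn {g : ℝ → ℝ} {a b : ℝ}
    (hg : ContinuousOn g (Icc a b)) {x : ℝ} (hx : x ∈ Icc a b) :
    HasDerivWithinAt (fun x => ∫ t in a..x, g t) (g x) (Icc a b) x := by
  have hab : a ≤ b := hx.1.trans hx.2
  have : Fact (x ∈ Icc a b) := ⟨hx⟩
  refine intervalIntegral.integral_hasDerivWithinAt_right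
    ((hg.mono (Icc_subset_Icc_right hx.2)).intervalIntegrable_of_Icc hx.1) (s := Icc a b)
    (t := Icc a b) ?_ (hg x hx)
  exact (hg.stronglyMeasurableAtFilter_nhdsWithin measurableSet_Icc x)

/-- An absolutely continuous function whose almost everywhere derivative is continuous is
continuously differentiable. -/
lemma hasDerivWithinAt_of_absolutelyContinuousOnInterval {f g : ℝ → ℝ} {a b : ℝ} (hab : a ≤ b)
    (hf : AbsolutelyContinuousOnInterval f a b) (hg : ContinuousOn g (Icc a b))
    (hfg : ∀ᵐ x, x ∈ Icc a b → HasDerivAt f (g x) x) {x : ℝ} (hx : x ∈ Icc a b) :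
    HasDerivWithinAt f (g x) (Icc a b) x := by
  have key : ∀ x ∈ Icc a b, f x = f a + ∫ t in a..x, g t := by
    intro x hx
    have h1 := (hf.mono (c := a) (d := x) (by
      rw [uIcc_of_le hx.1, uIcc_of_le hab]; exact Icc_subset_Icc_right hx.2)).integral_deriv_eq_sub
    have h2 : ∫ t in a..x, deriv f t = ∫ t in a..x, g t := by
      apply intervalIntegral.integral_congr_ae
      filter_upwards [hfg] with t ht ht'
      rw [uIoc_of_le hx.1] at ht'
      exact (ht ⟨ht'.1.le, ht'.2.trans hx.2⟩).deriv
    linarith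
  exact ((hasDerivWithinAt_integral_of_continuousOn hg hx).const_add (f a)).congr
    key (key x hx)

lemma absolutelyContinuousOnInterval_of_hasDerivWithinAt {f g : ℝ → ℝ} {a b : ℝ} (hab : a ≤ b)
    (hg : ContinuousOn g (Icc a b))
    (hf : ∀ x ∈ Icc a b, HasDerivWithinAt f (g x) (Icc a b) x) :
    AbsolutelyContinuousOnInterval f a b := by
  obtain ⟨C, hC⟩ := isCompact_Icc.exists_bound_of_continuousOn hg
  have : LipschitzOnWith (Real.toNNReal C) f (Icc a b) :=
    (convex_Icc a b).lipschitzOnWith_of_nnnorm_hasDerivWithin_le hf (fun x hx => by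
      rw [← NNReal.coe_le_coe]
      exact (hC x hx).trans (Real.le_coe_toNNReal C))
  apply LipschitzOnWith.absolutelyContinuousOnInterval (K := Real.toNNReal C)
  rwa [uIcc_of_le hab]

lemma ae_unitMeasure_iff {P : ℝ → Prop} :
    (∀ᵐ x ∂unitMeasure, P x) ↔ ∀ᵐ x, x ∈ Icc (0 : ℝ) 1 → P x := by
  rw [unitMeasure, ae_restrict_iff' measurableSet_Icc]

lemma intervalIntegrable_of_unitMeasure {q : ℝ → ℝ} (hq : Integrable q unitMeasure) :
    IntervalIntegrable q volume 0 1 := by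
  rw [intervalIntegrable_iff_integrableOn_Icc_of_le zero_le_one]
  exact hq

/-! ### Equivalence of Carathéodory solutions and the quasi-derivative system -/

section Regularization

variable {q : ℝ → ℝ} {μ : ℝ}

lemma primitive_absolutelyContinuous (hq : Integrable q unitMeasure) :
    AbsolutelyContinuousOnInterval (primitive q) 0 1 :=
  (intervalIntegrable_of_unitMeasure hq).absolutelyContinuousOnInterval_intervalIntegral (by simp)

lemma primitive_continuousOn (hq : Integrable q unitMeasure) :
    ContinuousOn (primitive q) (Icc 0 1) := by
  have := (primitive_absolutelyContinuous hq).continuousOn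
  rwa [uIcc_of_le zero_le_one] at this

lemma primitive_ae_hasDerivAt (hq : Integrable q unitMeasure) :
    ∀ᵐ x, x ∈ Icc (0 : ℝ) 1 → HasDerivAt (primitive q) (q x) x := by
  have := (intervalIntegrable_of_unitMeasure hq).ae_hasDerivAt_integral
  rw [uIcc_of_le zero_le_one] at this
  filter_upwards [this] with x hx hx'
  exact hx hx' 0 (by simp)

lemma ae_hasDerivAt_of_hasDerivWithinAt {f g : ℝ → ℝ} {a b : ℝ}
    (hf : ∀ x ∈ Icc a b, HasDerivWithinAt f (g x) (Icc a b) x) :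
    ∀ᵐ x, x ∈ Icc a b → HasDerivAt f (g x) x := by
  have h₁ : ∀ᵐ x : ℝ, x ≠ a := by simp [ae_iff, measure_singleton]
  have h₂ : ∀ᵐ x : ℝ, x ≠ b := by simp [ae_iff, measure_singleton]
  filter_upwards [h₁, h₂] with x h1 h2 hx
  exact (hf x hx).hasDerivAt
    (Icc_mem_nhds (lt_of_le_of_ne hx.1 h1.symm) (lt_of_le_of_ne hx.2 h2))

/-- The terms in `q` cancel in `(z - Q y)' = (q - μ) y - q y - Q z`. What remains is continuous, so
the quasi-derivative is differentiable everywhere and not only almost everywhere. -/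
lemma isRegularized_of_isSolution (hq : Integrable q unitMeasure) {y z : ℝ → ℝ}
    (hy : ∀ x ∈ Icc (0 : ℝ) 1, HasDerivWithinAt y (z x) (Icc 0 1) x)
    (hz : AbsolutelyContinuousOnInterval z 0 1)
    (hzy : ∀ᵐ x ∂unitMeasure, HasDerivAt z ((q x - μ) * y x) x) :
    IsRegularized (primitive q) μ y (fun x => z x - primitive q x * y x) := by
  have hzc : ContinuousOn z (Icc 0 1) := by
    have := hz.continuousOn
    rwa [uIcc_of_le zero_le_one] at this
  have hyc : ContinuousOn y (Icc 0 1) := fun x hx => (hy x hx).continuousWithinAt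
  have hyac := absolutelyContinuousOnInterval_of_hasDerivWithinAt zero_le_one hzc hy
  have hQ := primitive_continuousOn hq
  intro x hx
  refine ⟨by simpa using hy x hx, ?_⟩
  refine hasDerivWithinAt_of_absolutelyContinuousOnInterval
    (f := fun x => z x - primitive q x * y x)
    (g := fun x => -(primitive q x * (z x - primitive q x * y x)) -
      (primitive q x ^ 2 + μ) * y x) zero_le_one
    (hz.fun_sub ((primitive_absolutelyContinuous hq).fun_mul hyac)) (by fun_prop) ?_ hx
  rw [ae_unitMeasure_iff] at hzy
  filter_upwards [hzy, primitive_ae_hasDerivAt hq, ae_hasDerivAt_of_hasDerivWithinAt hy]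
    with t h1 h2 h3 ht
  convert! (h1 ht).sub ((h2 ht).mul (h3 ht)) using 1
  ring

lemma IsRegularized.continuousOn {Q y u : ℝ → ℝ} (h : IsRegularized Q μ y u) :
    ContinuousOn y (Icc 0 1) ∧ ContinuousOn u (Icc 0 1) :=
  ⟨fun x hx => (h x hx).1.continuousWithinAt, fun x hx => (h x hx).2.continuousWithinAt⟩

/-- Kept separate from `IsRegularized.isSolution` because the variation of constants formula needs
the explicit derivative `u + Q y`. -/
lemma IsRegularized.isSolution_aux (hq : Integrable q unitMeasure) {y u : ℝ → ℝ}
    (h : IsRegularized (primitive q) μ y u) :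
    (∀ x ∈ Icc (0 : ℝ) 1,
      HasDerivWithinAt y (u x + primitive q x * y x) (Icc 0 1) x) ∧
    AbsolutelyContinuousOnInterval (fun x => u x + primitive q x * y x) 0 1 ∧
    ∀ᵐ x ∂unitMeasure, HasDerivAt (fun x => u x + primitive q x * y x) ((q x - μ) * y x) x := by
  have hQ := primitive_continuousOn hq
  obtain ⟨hyc, huc⟩ := h.continuousOn
  have hy := fun x hx => (h x hx).1
  have hu := fun x hx => (h x hx).2
  refine ⟨hy, ?_, ?_⟩
  · exact (absolutelyContinuousOnInterval_of_hasDerivWithinAt zero_le_one (by fun_prop) hu).fun_add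
      ((primitive_absolutelyContinuous hq).fun_mul
        (absolutelyContinuousOnInterval_of_hasDerivWithinAt zero_le_one (by fun_prop) hy))
  · rw [ae_unitMeasure_iff]
    filter_upwards [ae_hasDerivAt_of_hasDerivWithinAt hu, primitive_ae_hasDerivAt hq,
      ae_hasDerivAt_of_hasDerivWithinAt hy] with t h1 h2 h3 ht
    convert! (h1 ht).add ((h2 ht).mul (h3 ht)) using 1
    ring

lemma IsRegularized.isSolution (hq : Integrable q unitMeasure) {y u : ℝ → ℝ}
    (h : IsRegularized (primitive q) μ y u) : IsSolution q μ y :=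
  ⟨_, h.isSolution_aux hq⟩

lemma IsSolution.exists_isRegularized (hq : Integrable q unitMeasure) {y : ℝ → ℝ}
    (h : IsSolution q μ y) : ∃ u, IsRegularized (primitive q) μ y u := by
  obtain ⟨z, h1, h2, h3⟩ := h
  exact ⟨_, isRegularized_of_isSolution hq h1 h2 h3⟩

end Regularization

lemma hasDerivWithinAt_Ici_of_Icc {f : ℝ → ℝ} {f' a b x : ℝ} (hx : x ∈ Ico a b)
    (h : HasDerivWithinAt f f' (Icc a b) x) : HasDerivWithinAt f f' (Ici x) x :=
  h.mono_of_mem_nhdsWithin (Icc_mem_nhdsGE_of_mem hx)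

/-- A function that has a positive derivative wherever it vanishes cannot return to zero. -/
lemma pos_of_hasDerivWithinAt_pos_of_eq_zero {g g' : ℝ → ℝ} {a b : ℝ}
    (hg : ∀ x ∈ Icc a b, HasDerivWithinAt g (g' x) (Icc a b) x) (ha : 0 ≤ g a)
    (hpos : ∀ x ∈ Icc a b, g x = 0 → 0 < g' x) {x : ℝ} (hx : x ∈ Ioc a b) : 0 < g x := by
  have hc : ContinuousOn g (Icc a b) := fun x hx => (hg x hx).continuousWithinAt
  have hnonneg : ∀ ⦃x⦄, x ∈ Icc a b → -g x ≤ 0 :=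
    image_le_of_deriv_right_lt_deriv_boundary (f := fun x => -g x) (f' := fun x => -g' x)
      (B := fun _ => 0) (B' := fun _ => 0) hc.neg
      (fun x hx => (hasDerivWithinAt_Ici_of_Icc hx (hg x (Ico_subset_Icc_self hx))).neg)
      (by simpa using ha) (fun x => hasDerivAt_const x 0)
      (fun x hx h => by simpa using hpos x (Ico_subset_Icc_self hx) (by simpa using h))
  have hxI : x ∈ Icc a b := Ioc_subset_Icc_self hx
  have h0 : 0 ≤ g x := by simpa using hnonneg hxI
  refine lt_of_le_of_ne h0 fun h => ?_
  have hd : HasDerivWithinAt g (g' x) (Icc a x) x := (hg x hxI).mono (Icc_subset_Icc_right hx.2)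
  have hlt := hpos x hxI h.symm
  rw [hasDerivWithinAt_iff_tendsto_slope, Icc_sdiff_right] at hd
  have hev := hd.eventually (lt_mem_nhds hlt)
  have hne : (nhdsWithin x (Ico a x)).NeBot := by
    apply mem_closure_iff_nhdsWithin_neBot.1
    rw [closure_Ico hx.1.ne]
    exact ⟨hx.1.le, le_rfl⟩
  obtain ⟨t, ht, htI⟩ := (hev.and self_mem_nhdsWithin).exists
  rw [slope_def_field, ← h] at ht
  have h1 : 0 ≤ g t := by simpa using hnonneg (⟨htI.1, htI.2.le.trans hx.2⟩ : t ∈ Icc a b)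
  have : (0 - g t) / (x - t) ≤ 0 :=
    div_nonpos_of_nonpos_of_nonneg (by linarith) (by linarith [htI.2])
  have h2 : (g t - 0) / (t - x) = (0 - g t) / (x - t) := by
    rw [← neg_div_neg_eq]; ring_nf
  linarith

lemma exists_integrating_factor {A : ℝ → ℝ} (hA : ContinuousOn A (Icc 0 1)) :
    ∃ G : ℝ → ℝ, G 0 = 1 ∧ (∀ x, 0 < G x) ∧
      ∀ x ∈ Icc (0 : ℝ) 1, HasDerivWithinAt G (A x * G x) (Icc 0 1) x := by
  refine ⟨fun x => Real.exp (∫ t in (0 : ℝ)..x, A t), by simp, fun x => Real.exp_pos _,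
    fun x hx => ?_⟩
  convert! (hasDerivWithinAt_integral_of_continuousOn hA hx).exp using 1
  ring

/-! ### The Prüfer angle: existence, monotonicity, continuous dependence -/

section Prufer

variable {Q : ℝ → ℝ} {μ : ℝ}

lemma exists_nonneg_bound (hQ : ContinuousOn Q (Icc 0 1)) :
    ∃ M, 0 ≤ M ∧ ∀ x ∈ Icc (0 : ℝ) 1, |Q x| ≤ M := by
  obtain ⟨M, hM⟩ := isCompact_Icc.exists_bound_of_continuousOn hQ
  exact ⟨M, (abs_nonneg _).trans (hM 0 (by simp)), hM⟩

lemma abs_pruferField_le {M x : ℝ} (hM : |Q x| ≤ M) (t : ℝ) :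
    |pruferField Q μ x t| ≤ (1 + M) ^ 2 + |μ| := by
  have h1 : |Real.cos t + Q x * Real.sin t| ≤ 1 + M := by
    refine (abs_add_le _ _).trans (add_le_add (Real.abs_cos_le_one t) ?_)
    rw [abs_mul]
    calc |Q x| * |Real.sin t| ≤ |Q x| * 1 := by
          gcongr; exact Real.abs_sin_le_one t
      _ ≤ M := by simpa using hM
  have h2 : |Real.sin t ^ 2| ≤ 1 := by
    rw [abs_pow]; exact pow_le_one₀ (abs_nonneg _) (Real.abs_sin_le_one t)
  refine (abs_add_le _ _).trans (add_le_add ?_ ?_)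
  · rw [abs_pow]; gcongr
  · rw [abs_mul]
    calc |μ| * |Real.sin t ^ 2| ≤ |μ| * 1 := by gcongr
      _ = _ := mul_one _

lemma lipschitzWith_pruferField {M x : ℝ} (hM0 : 0 ≤ M) (hM : |Q x| ≤ M) :
    LipschitzWith (Real.toNNReal (2 * ((1 + M) ^ 2 + |μ|))) (pruferField Q μ x) := by
  have hd : ∀ t, HasDerivAt (pruferField Q μ x)
      (2 * ((Real.cos t + Q x * Real.sin t) * (-Real.sin t + Q x * Real.cos t) +
        μ * (Real.sin t * Real.cos t))) t := by
    intro t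
    have h1 := (Real.hasDerivAt_cos t).add ((Real.hasDerivAt_sin t).const_mul (Q x))
    convert! (h1.pow 2).add (((Real.hasDerivAt_sin t).pow 2).const_mul μ) using 1
    simp
    ring
  refine lipschitzWith_of_nnnorm_deriv_le (fun t => (hd t).differentiableAt) fun t => ?_
  rw [(hd t).deriv, ← NNReal.coe_le_coe, coe_nnnorm, Real.norm_eq_abs,
    Real.coe_toNNReal _ (by positivity), abs_mul, abs_of_pos two_pos]
  have hs := Real.abs_sin_le_one t
  have hc := Real.abs_cos_le_one t
  have h1 : |Real.cos t + Q x * Real.sin t| ≤ 1 + M := by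
    refine (abs_add_le _ _).trans (add_le_add hc ?_)
    rw [abs_mul]
    simpa using mul_le_mul hM hs (abs_nonneg _) hM0
  have h2 : |-Real.sin t + Q x * Real.cos t| ≤ 1 + M := by
    refine (abs_add_le _ _).trans (add_le_add (by simpa using hs) ?_)
    rw [abs_mul]
    simpa using mul_le_mul hM hc (abs_nonneg _) hM0
  have h3 : |Real.sin t * Real.cos t| ≤ 1 := by
    rw [abs_mul]; exact mul_le_one₀ hs (abs_nonneg _) hc
  gcongr
  refine (abs_add_le _ _).trans (add_le_add ?_ ?_)
  · rw [abs_mul, sq]; gcongr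
  · rw [abs_mul]; simpa using mul_le_mul_of_nonneg_left h3 (abs_nonneg μ)

/-- The field is bounded and Lipschitz in the angle, uniformly in `x`. Picard–Lindelöf with radius
equal to the bound therefore covers all of `[0, 1]` at once. -/
lemma exists_isPruferAngle (hQ : ContinuousOn Q (Icc 0 1)) (μ θ₀ : ℝ) :
    ∃ θ : ℝ → ℝ, θ 0 = θ₀ ∧ IsPruferAngle Q μ θ := by
  obtain ⟨M, hM0, hM⟩ := exists_nonneg_bound hQ
  have hP : IsPicardLindelof (pruferField Q μ) (tmin := 0) (tmax := 1) ⟨0, by simp⟩ θ₀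
      (Real.toNNReal ((1 + M) ^ 2 + |μ|)) 0 (Real.toNNReal ((1 + M) ^ 2 + |μ|))
      (Real.toNNReal (2 * ((1 + M) ^ 2 + |μ|))) := by
    refine ⟨fun t ht => (lipschitzWith_pruferField hM0 (hM t ht)).lipschitzOnWith,
      fun t _ => ?_, fun t ht s _ => ?_, ?_⟩
    · unfold pruferField; fun_prop
    · exact (abs_pruferField_le (hM t ht) s).trans (Real.le_coe_toNNReal _)
    · simp
  obtain ⟨θ, h0, h⟩ := hP.exists_eq_forall_mem_Icc_hasDerivWithinAt₀
  exact ⟨θ, h0, h⟩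

lemma IsPruferAngle.continuousOn {θ : ℝ → ℝ} (h : IsPruferAngle Q μ θ) :
    ContinuousOn θ (Icc 0 1) := fun x hx => (h x hx).continuousWithinAt

/-- Once the angle is known, the amplitude solves a scalar linear equation, hence is an exponential
and never vanishes. -/
lemma IsPruferAngle.exists_isRegularized (hQ : ContinuousOn Q (Icc 0 1)) {θ : ℝ → ℝ}
    (h : IsPruferAngle Q μ θ) : ∃ ρ : ℝ → ℝ, ρ 0 = 1 ∧ (∀ x, 0 < ρ x) ∧
      IsRegularized Q μ (fun x => ρ x * Real.sin (θ x)) (fun x => ρ x * Real.cos (θ x)) := by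
  have hθ := h.continuousOn
  obtain ⟨ρ, h0, hpos, hρ⟩ := exists_integrating_factor
    (A := fun x => Real.sin (θ x) * Real.cos (θ x) * (1 - Q x ^ 2 - μ) +
      Q x * (Real.sin (θ x) ^ 2 - Real.cos (θ x) ^ 2)) (by fun_prop)
  refine ⟨ρ, h0, hpos, fun x hx => ⟨?_, ?_⟩⟩
  · convert! (hρ x hx).mul (h x hx).sin using 1
    unfold pruferField
    linear_combination
      -(Real.cos (θ x) + Q x * Real.sin (θ x)) * ρ x * Real.sin_sq_add_cos_sq (θ x)
  · convert! (hρ x hx).mul (h x hx).cos using 1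
    unfold pruferField
    linear_combination
      ((Q x ^ 2 + μ) * Real.sin (θ x) + Q x * Real.cos (θ x)) * ρ x *
        Real.sin_sq_add_cos_sq (θ x)

/-- The matrix of the system has trace zero. -/
lemma IsRegularized.wronskian_eq {y₁ u₁ y₂ u₂ : ℝ → ℝ} (h₁ : IsRegularized Q μ y₁ u₁)
    (h₂ : IsRegularized Q μ y₂ u₂) {x : ℝ} (hx : x ∈ Icc (0 : ℝ) 1) :
    y₁ x * u₂ x - u₁ x * y₂ x = y₁ 0 * u₂ 0 - u₁ 0 * y₂ 0 := by
  have hd : ∀ x ∈ Icc (0 : ℝ) 1,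
      HasDerivWithinAt (fun x => y₁ x * u₂ x - u₁ x * y₂ x) 0 (Icc 0 1) x := fun x hx => by
    convert! ((h₁ x hx).1.mul (h₂ x hx).2).sub ((h₁ x hx).2.mul (h₂ x hx).1) using 1
    ring
  exact constant_of_has_deriv_right_zero (f := fun x => y₁ x * u₂ x - u₁ x * y₂ x)
    (fun x hx => (hd x hx).continuousWithinAt)
    (fun x hx => hasDerivWithinAt_Ici_of_Icc hx (hd x (Ico_subset_Icc_self hx))) x hx

/-- Every solution vanishing at `0` is a multiple of the one given by the Prüfer angle. -/
lemma IsRegularized.eq_of_eq_zero (hQ : ContinuousOn Q (Icc 0 1)) {y u Y U : ℝ → ℝ}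
    (h : IsRegularized Q μ y u) (hY : IsRegularized Q μ Y U) (h0 : y 0 = 0) (hY0 : Y 0 = 0)
    (hU0 : U 0 = 1) {x : ℝ} (hx : x ∈ Icc (0 : ℝ) 1) :
    y x = u 0 * Y x ∧ u x = u 0 * U x := by
  -- The initial angle `π / 2` produces a companion solution with value `1` and quasi-derivative `0`
  -- at `0`. The three constant Wronskians then determine `y` and `u` by linear algebra.
  obtain ⟨θ, hθ0, hθ⟩ := exists_isPruferAngle hQ μ (Real.pi / 2)
  obtain ⟨ρ, hρ0, -, hF⟩ := hθ.exists_isRegularized hQ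
  have h1 := h.wronskian_eq hY hx
  have h2 := h.wronskian_eq hF hx
  have h3 := hY.wronskian_eq hF hx
  simp only [h0, hY0, hU0, hθ0, hρ0, Real.sin_pi_div_two, Real.cos_pi_div_two] at h1 h2 h3
  constructor
  · linear_combination (ρ x * Real.sin (θ x)) * h1 + y x * h3 - Y x * h2
  · linear_combination (ρ x * Real.cos (θ x)) * h1 + u x * h3 - U x * h2

/-- Strict monotonicity of the Prüfer angle in the spectral parameter. -/
lemma IsPruferAngle.lt_of_lt (hQ : ContinuousOn Q (Icc 0 1)) {ν : ℝ} {θ η : ℝ → ℝ}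
    (hη : IsPruferAngle Q ν η) (hθ : IsPruferAngle Q μ θ) (h0 : η 0 = θ 0) (hνμ : ν < μ)
    {x : ℝ} (hx : x ∈ Ioc (0 : ℝ) 1) : η x < θ x := by
  have hθc := hθ.continuousOn
  have hηc := hη.continuousOn
  have hsc := Real.continuous_sinc
  -- Writing `sin d = d sinc d` for `d = θ - η` turns the difference of the two equations into a
  -- linear equation for `d` with source `(μ - ν) sin² η ≥ 0`. The factor `G` removes the linear
  -- term, so `d G` is nondecreasing.
  obtain ⟨G, hG0, hGpos, hG⟩ := exists_integrating_factor
    (A := fun x => -(Real.sinc (θ x - η x) * (2 * Q x * Real.cos (θ x + η x) -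
      (1 - Q x ^ 2 - μ) * Real.sin (θ x + η x)))) (by fun_prop)
  have hd : ∀ x ∈ Icc (0 : ℝ) 1, HasDerivWithinAt (fun x => (θ x - η x) * G x)
      ((μ - ν) * Real.sin (η x) ^ 2 * G x) (Icc 0 1) x := by
    intro x hx
    convert! ((hθ x hx).sub (hη x hx)).mul (hG x hx) using 1
    have hs : (θ x - η x) * Real.sinc (θ x - η x) = Real.sin (θ x - η x) := by
      rw [Real.sinc_apply]
      split_ifs with h
      · simp [h]
      · field_simp
    have key : pruferField Q μ x (θ x) - pruferField Q ν x (η x) =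
        Real.sin (θ x - η x) * (2 * Q x * Real.cos (θ x + η x) -
      (1 - Q x ^ 2 - μ) * Real.sin (θ x + η x)) + (μ - ν) * Real.sin (η x) ^ 2 := by
      unfold pruferField
      rw [Real.sin_sub, Real.cos_add, Real.sin_add]
      have e1 := Real.sin_sq_add_cos_sq (θ x)
      have e2 := Real.sin_sq_add_cos_sq (η x)
      set s := Real.sin (θ x)
      set c := Real.cos (θ x)
      set s' := Real.sin (η x)
      set c' := Real.cos (η x)
      have e3 : c ^ 2 = 1 - s ^ 2 := by linarith
      have e4 : c' ^ 2 = 1 - s' ^ 2 := by linarith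
      ring_nf
      simp only [e3, e4]
      ring
    simp only [Pi.sub_apply]
    linear_combination (-G x) * key + G x * (2 * Q x * Real.cos (θ x + η x) -
      (1 - Q x ^ 2 - μ) * Real.sin (θ x + η x)) * hs
  have hmono : MonotoneOn (fun x => (θ x - η x) * G x) (Icc 0 1) := by
    refine monotoneOn_of_hasDerivWithinAt_nonneg (convex_Icc 0 1)
      (fun x hx => (hd x hx).continuousWithinAt)
      (fun x hx => (hd x (interior_subset hx)).mono interior_subset) (fun x _ => ?_)
    have := (hGpos x).le
    have := sub_pos.2 hνμ
    positivity
  have hxI := Ioc_subset_Icc_self hx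
  have h1 : 0 ≤ (θ x - η x) * G x := by
    have := hmono (by simp : (0 : ℝ) ∈ Icc (0 : ℝ) 1) hxI hx.1.le
    simpa [h0] using this
  have h2 : 0 ≤ θ x - η x := nonneg_of_mul_nonneg_left h1 (hGpos x)
  -- Equality at `x` would make `d G` vanish on `[0, x]`, so the source would vanish and `sin η = 0`
  -- on `(0, x)`. This is impossible, since `η' = cos² η = 1` there.
  refine lt_of_le_of_ne (by linarith) fun hxe => ?_
  have hconst : ∀ t ∈ Icc 0 x, (θ t - η t) * G t = 0 := by
    intro t ht
    have htI : t ∈ Icc (0 : ℝ) 1 := ⟨ht.1, ht.2.trans hx.2⟩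
    have a1 := hmono (by simp : (0 : ℝ) ∈ Icc (0 : ℝ) 1) htI ht.1
    have a2 := hmono htI hxI ht.2
    simp only [h0, hxe, sub_self, zero_mul] at a1 a2
    exact le_antisymm a2 a1
  have hsin : ∀ t ∈ Ioo 0 x, Real.sin (η t) = 0 := by
    intro t ht
    have htI : t ∈ Icc (0 : ℝ) 1 := ⟨ht.1.le, ht.2.le.trans hx.2⟩
    have d1 := (hd t htI).hasDerivAt (Icc_mem_nhds ht.1 (ht.2.trans_le hx.2))
    have d2 : HasDerivAt (fun x => (θ x - η x) * G x) 0 t := by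
      refine (hasDerivAt_const t (0 : ℝ)).congr_of_eventuallyEq ?_
      filter_upwards [Ioo_mem_nhds ht.1 ht.2] with r hr
      exact hconst r (Ioo_subset_Icc_self hr)
    have := d1.unique d2
    have h3 := (hGpos t).ne'
    have h4 := (sub_pos.2 hνμ).ne'
    simpa [h3, h4] using this
  obtain ⟨t, ht⟩ : (Ioo 0 x).Nonempty := nonempty_Ioo.2 hx.1
  have htI : t ∈ Icc (0 : ℝ) 1 := ⟨ht.1.le, ht.2.le.trans hx.2⟩
  have d1 := ((hη t htI).hasDerivAt (Icc_mem_nhds ht.1 (ht.2.trans_le hx.2))).sin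
  have d2 : HasDerivAt (fun x => Real.sin (η x)) 0 t := by
    refine (hasDerivAt_const t (0 : ℝ)).congr_of_eventuallyEq ?_
    filter_upwards [Ioo_mem_nhds ht.1 ht.2] with r hr
    exact hsin r hr
  have h5 := d1.unique d2
  have h6 := Real.sin_sq_add_cos_sq (η t)
  simp only [pruferField, hsin t ht] at h5 h6
  have h7 : Real.cos (η t) ≠ 0 := by
    intro h; simp [h] at h6
  simp [h7] at h5

/-- Continuous dependence of the Prüfer angle on the coefficients. -/
lemma IsPruferAngle.exists_abs_sub_lt (hQ : ContinuousOn Q (Icc 0 1)) {θ : ℝ → ℝ}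
    (hθ : IsPruferAngle Q μ θ) {ε : ℝ} (hε : 0 < ε) : ∃ δ > 0, ∀ (Q' : ℝ → ℝ) (μ' : ℝ)
      (θ' : ℝ → ℝ), IsPruferAngle Q' μ' θ' → θ' 0 = θ 0 →
      (∀ x ∈ Icc (0 : ℝ) 1, |Q' x - Q x| ≤ δ) → |μ' - μ| ≤ δ →
      ∀ x ∈ Icc (0 : ℝ) 1, |θ' x - θ x| < ε := by
  obtain ⟨M, hM0, hM⟩ := exists_nonneg_bound hQ
  set K := Real.toNNReal (2 * ((1 + M) ^ 2 + |μ|))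
  have hcont := (gronwallBound_continuous_ε 0 K 1).tendsto 0
  rw [gronwallBound_ε0_δ0] at hcont
  obtain ⟨r, hr, hr'⟩ := Metric.eventually_nhds_iff.1 (hcont.eventually (gt_mem_nhds hε))
  -- A change of `Q` and `μ` by at most `δ ≤ 1` changes the field by at most `δ (2M + 3) + δ`. The
  -- extra factor `2` makes this strictly less than the Grönwall tolerance `r`.
  refine ⟨min 1 (r / (2 * (2 * M + 4))), by positivity, ?_⟩
  intro Q' μ' θ' hθ' h0 hQ' hμ' x hx
  set δ := min 1 (r / (2 * (2 * M + 4)))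
  have hδ0 : 0 ≤ δ := by positivity
  have hδ1 : δ ≤ 1 := min_le_left _ _
  have hδr : δ * (2 * M + 4) < r := by
    have : δ ≤ r / (2 * (2 * M + 4)) := min_le_right _ _
    rw [le_div_iff₀ (by positivity)] at this
    linarith
  have hfield : ∀ t ∈ Icc (0 : ℝ) 1,
      |pruferField Q' μ' t (θ' t) - pruferField Q μ t (θ' t)| ≤ δ * (2 * M + 4) := by
    intro t ht
    have e : pruferField Q' μ' t (θ' t) - pruferField Q μ t (θ' t) =
        (Q' t - Q t) * (Real.sin (θ' t) * (2 * Real.cos (θ' t) +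
          ((Q' t - Q t) + 2 * Q t) * Real.sin (θ' t))) +
        (μ' - μ) * (Real.sin (θ' t) * Real.sin (θ' t)) := by
      unfold pruferField; ring
    have hs := Real.abs_sin_le_one (θ' t)
    have hc := Real.abs_cos_le_one (θ' t)
    have h1 : |Real.sin (θ' t) * (2 * Real.cos (θ' t) +
          ((Q' t - Q t) + 2 * Q t) * Real.sin (θ' t))| ≤ 1 * (2 * 1 + (1 + 2 * M) * 1) := by
      rw [abs_mul]
      refine mul_le_mul hs ((abs_add_le _ _).trans (add_le_add ?_ ?_)) (abs_nonneg _) zero_le_one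
      · rw [abs_mul, abs_two]; gcongr
      · rw [abs_mul]
        refine mul_le_mul ((abs_add_le _ _).trans (add_le_add ((hQ' t ht).trans hδ1) ?_)) hs
          (abs_nonneg _) (by positivity)
        rw [abs_mul, abs_two]; gcongr; exact hM t ht
    have h2 : |Real.sin (θ' t) * Real.sin (θ' t)| ≤ 1 * 1 := by
      rw [abs_mul]; exact mul_le_mul hs hs (abs_nonneg _) zero_le_one
    rw [e]
    calc _ ≤ δ * (1 * (2 * 1 + (1 + 2 * M) * 1)) + δ * (1 * 1) := by
          refine (abs_add_le _ _).trans (add_le_add ?_ ?_)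
          · rw [abs_mul]; exact mul_le_mul (hQ' t ht) h1 (abs_nonneg _) hδ0
          · rw [abs_mul]; exact mul_le_mul hμ' h2 (abs_nonneg _) hδ0
      _ = _ := by ring
  have hg := dist_le_of_approx_trajectories_ODE_of_mem (v := pruferField Q μ) (s := fun _ => univ)
    (K := K) (f := θ') (g := θ) (a := 0) (b := 1) (εf := δ * (2 * M + 4)) (εg := 0) (δ := 0)
    (fun t ht => (lipschitzWith_pruferField hM0 (hM t (Ico_subset_Icc_self ht))).lipschitzOnWith)
    hθ'.continuousOn
    (fun t ht => hasDerivWithinAt_Ici_of_Icc ht (hθ' t (Ico_subset_Icc_self ht)))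
    (fun t ht => hfield t (Ico_subset_Icc_self ht)) (fun _ _ => mem_univ _)
    hθ.continuousOn
    (fun t ht => hasDerivWithinAt_Ici_of_Icc ht (hθ t (Ico_subset_Icc_self ht)))
    (fun t _ => by simp) (fun _ _ => mem_univ _) (by simp [h0]) x hx
  rw [add_zero, sub_zero, Real.dist_eq] at hg
  refine hg.trans_lt (lt_of_le_of_lt ?_ (hr' (y := δ * (2 * M + 4)) ?_))
  · exact gronwallBound_mono le_rfl (by positivity) K.2 hx.2
  · rw [Real.dist_eq, sub_zero, abs_of_nonneg (by positivity)]; exact hδr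

end Prufer

/-! ### Zeros of solutions and multiples of `π` -/

section Zeros

variable {Q : ℝ → ℝ} {μ : ℝ} {θ : ℝ → ℝ}

lemma pruferField_of_sin_eq_zero {x t : ℝ} (ht : Real.sin t = 0) : pruferField Q μ x t = 1 := by
  have := Real.sin_sq_add_cos_sq t
  simp only [pruferField, ht] at this ⊢
  linarith

/-- The Prüfer angle crosses multiples of `π` upwards only. -/
lemma IsPruferAngle.int_mul_pi_lt (hθ : IsPruferAngle Q μ θ) {k : ℤ} {s t : ℝ} (hs : 0 ≤ s)
    (hk : k * Real.pi ≤ θ s) (hst : s < t) (ht : t ≤ 1) : k * Real.pi < θ t := by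
  have := pos_of_hasDerivWithinAt_pos_of_eq_zero (g := fun x => θ x - k * Real.pi) (a := s) (b := 1)
    (fun x hx => ((hθ x ⟨hs.trans hx.1, hx.2⟩).mono (Icc_subset_Icc_left hs)).sub_const _)
    (by linarith) (fun x _ h => by
      rw [pruferField_of_sin_eq_zero]
      · exact one_pos
      · rw [sub_eq_zero.1 h]; exact Real.sin_int_mul_pi k) ⟨hst, ht⟩
  linarith

lemma IsPruferAngle.nat_mul_pi_lt (hθ : IsPruferAngle Q μ θ) {k : ℕ} {s t : ℝ} (hs : 0 ≤ s)
    (hk : k * Real.pi ≤ θ s) (hst : s < t) (ht : t ≤ 1) : k * Real.pi < θ t := by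
  have := hθ.int_mul_pi_lt (k := k) hs (by simpa using hk) hst ht
  simpa using this

lemma IsPruferAngle.pos (hθ : IsPruferAngle Q μ θ) (h0 : θ 0 = 0) {t : ℝ} (ht : t ∈ Ioc 0 1) :
    0 < θ t := by
  simpa using hθ.nat_mul_pi_lt (k := 0) le_rfl (by simp [h0]) ht.1 ht.2

lemma IsPruferAngle.lt_of_eq_nat_mul_pi (hθ : IsPruferAngle Q μ θ) {j k : ℕ} (hjk : j < k)
    {s t : ℝ} (hs : s ≤ 1) (ht : 0 ≤ t) (hsj : θ s = j * Real.pi) (htk : θ t = k * Real.pi) :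
    s < t := by
  have hlt : (j : ℝ) * Real.pi < k * Real.pi := by
    have := Real.pi_pos
    gcongr
  by_contra! hle
  rcases hle.lt_or_eq with h | h
  · have := hθ.nat_mul_pi_lt ht htk.ge h hs
    linarith
  · rw [h] at htk; linarith

lemma IsPruferAngle.eq_of_eq_nat_mul_pi (hθ : IsPruferAngle Q μ θ) {k : ℕ}
    {s t : ℝ} (hs : s ∈ Icc (0 : ℝ) 1) (ht : t ∈ Icc (0 : ℝ) 1) (hsk : θ s = k * Real.pi)
    (htk : θ t = k * Real.pi) : s = t := by
  rcases lt_trichotomy s t with h | h | h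
  · have := hθ.nat_mul_pi_lt hs.1 hsk.ge h ht.2
    linarith
  · exact h
  · have := hθ.nat_mul_pi_lt ht.1 htk.ge h hs.2
    linarith

lemma exists_nat_of_sin_eq_zero {t : ℝ} (ht : 0 < t) (h : Real.sin t = 0) :
    ∃ k : ℕ, 0 < k ∧ t = k * Real.pi := by
  obtain ⟨n, hn⟩ := Real.sin_eq_zero_iff.1 h
  have hn0 : 0 < n := by
    have : 0 < (n : ℝ) := by
      by_contra! hle
      have := mul_nonpos_of_nonpos_of_nonneg hle Real.pi_pos.le
      linarith
    exact_mod_cast this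
  lift n to ℕ using hn0.le
  exact ⟨n, by exact_mod_cast hn0, by simpa using hn.symm⟩

lemma IsPruferAngle.exists_eq_nat_mul_pi (hθ : IsPruferAngle Q μ θ) (h0 : θ 0 = 0) {k : ℕ}
    {x : ℝ} (hx : x ∈ Icc (0 : ℝ) 1) (hk : θ x = k * Real.pi) {j : ℕ} (hj : j ≤ k) :
    ∃ t ∈ Icc 0 x, θ t = j * Real.pi := by
  have := Real.pi_pos
  refine intermediate_value_Icc hx.1 (hθ.continuousOn.mono (Icc_subset_Icc_right hx.2)) ?_
  rw [h0, hk]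
  exact ⟨by positivity, by gcongr⟩

/-- `f` is a bijection from `S` onto `{jπ : 0 < j < k}`. The same count serves for the zeros of a
solution and for the eigenvalues below a given one. -/
lemma encard_add_one_eq {S : Set ℝ} {f : ℝ → ℝ} {k : ℕ} (hk : 0 < k) (hf : InjOn f S)
    (h₁ : ∀ s ∈ S, ∃ j : ℕ, 0 < j ∧ j < k ∧ f s = j * Real.pi)
    (h₂ : ∀ j : ℕ, 0 < j → j < k → ∃ s ∈ S, f s = j * Real.pi) : S.encard + 1 = (k : ℕ∞) := by
  have himage : f '' S = (fun j : ℕ => (j : ℝ) * Real.pi) '' (Finset.Ioo 0 k : Finset ℕ) := by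
    ext x
    constructor
    · rintro ⟨s, hs, rfl⟩
      obtain ⟨j, hj0, hjk, hj⟩ := h₁ s hs
      exact ⟨j, by simp [hj0, hjk], hj.symm⟩
    · rintro ⟨j, hj, rfl⟩
      simp only [Finset.coe_Ioo, mem_Ioo] at hj
      exact h₂ j hj.1 hj.2
  have hinj : InjOn (fun j : ℕ => (j : ℝ) * Real.pi) (Finset.Ioo 0 k : Finset ℕ) := by
    intro a _ b _ hab
    simpa [Real.pi_ne_zero] using hab
  rw [← hf.encard_image, himage, hinj.encard_image, encard_coe_eq_coe_finsetCard, Nat.card_Ioo]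
  norm_cast
  omega

/-- Counting the zeros of a solution by its Prüfer angle. -/
lemma IsPruferAngle.encard_zeros (hθ : IsPruferAngle Q μ θ) (h0 : θ 0 = 0) {k : ℕ} (hk0 : 0 < k)
    {x : ℝ} (hx : x ∈ Icc (0 : ℝ) 1) (hk : θ x = k * Real.pi) :
    {t | t ∈ Ioo 0 x ∧ Real.sin (θ t) = 0}.encard + 1 = (k : ℕ∞) := by
  have key : ∀ s ∈ {t | t ∈ Ioo 0 x ∧ Real.sin (θ t) = 0},
      ∃ j : ℕ, 0 < j ∧ j < k ∧ θ s = j * Real.pi := by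
    rintro s ⟨hs, hs0⟩
    obtain ⟨j, hj0, hj⟩ :=
      exists_nat_of_sin_eq_zero (hθ.pos h0 ⟨hs.1, hs.2.le.trans hx.2⟩) hs0
    refine ⟨j, hj0, ?_, hj⟩
    by_contra! hle
    have h1 := hθ.nat_mul_pi_lt (k := k) hs.1.le (by
      rw [hj]; have := Real.pi_pos; gcongr) hs.2 hx.2
    linarith
  refine encard_add_one_eq (f := θ) hk0 ?_ key ?_
  · intro s hs t ht hst
    obtain ⟨j, -, -, hj⟩ := key s hs
    exact hθ.eq_of_eq_nat_mul_pi ⟨hs.1.1.le, hs.1.2.le.trans hx.2⟩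
      ⟨ht.1.1.le, ht.1.2.le.trans hx.2⟩ hj (hst ▸ hj)
  · intro j hj0 hjk
    obtain ⟨t, ht, htj⟩ := hθ.exists_eq_nat_mul_pi h0 hx hk hjk.le
    refine ⟨t, ⟨⟨?_, ?_⟩, ?_⟩, htj⟩
    · exact hθ.lt_of_eq_nat_mul_pi (j := 0) hj0 zero_le_one ht.1 (by simp [h0]) htj
    · exact hθ.lt_of_eq_nat_mul_pi hjk (ht.2.trans hx.2) hx.1 htj hk
    · rw [htj]; exact Real.sin_nat_mul_pi j

end Zeros

/-! ### Eigenvalues, their indices and nodes in terms of the Prüfer angle -/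

section Eigenvalues

variable {q : ℝ → ℝ} {μ : ℝ} {θ : ℝ → ℝ}

lemma IsRegularized.quasiderivative_ne_zero (hq : Integrable q unitMeasure) {y u Y U : ℝ → ℝ}
    (h : IsRegularized (primitive q) μ y u) (hY : IsRegularized (primitive q) μ Y U)
    (h0 : y 0 = 0) (hY0 : Y 0 = 0) (hU0 : U 0 = 1) (hne : ∃ x ∈ Icc (0 : ℝ) 1, y x ≠ 0) :
    u 0 ≠ 0 := by
  obtain ⟨x, hx, hyx⟩ := hne
  intro hu
  apply hyx
  simpa [hu] using (h.eq_of_eq_zero (primitive_continuousOn hq) hY h0 hY0 hU0 hx).1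

/-- Polar form of an eigenfunction. -/
lemma IsEigenfunction.exists_polar (hq : Integrable q unitMeasure)
    (hθ : IsPruferAngle (primitive q) μ θ) (h0 : θ 0 = 0) {y u : ℝ → ℝ}
    (hy : IsEigenfunction q μ y) (hu : IsRegularized (primitive q) μ y u) :
    ∃ r : ℝ → ℝ, (∀ x, r x ≠ 0) ∧ ∀ x ∈ Icc (0 : ℝ) 1,
      y x = r x * Real.sin (θ x) ∧ u x = r x * Real.cos (θ x) := by
  have hQ := primitive_continuousOn hq
  obtain ⟨ρ, hρ0, hρ, hY⟩ := hθ.exists_isRegularized hQ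
  have hu0 : u 0 ≠ 0 := IsRegularized.quasiderivative_ne_zero hq hu hY hy.2.1 (by simp [h0])
    (by simp [h0, hρ0]) hy.2.2.2
  refine ⟨fun x => u 0 * ρ x, fun x => mul_ne_zero hu0 (hρ x).ne', fun x hx => ?_⟩
  obtain ⟨h1, h2⟩ := hu.eq_of_eq_zero hQ hY hy.2.1 (by simp [h0]) (by simp [h0, hρ0]) hx
  exact ⟨by rw [h1]; ring, by rw [h2]; ring⟩

lemma IsEigenfunction.eq_zero_iff (hq : Integrable q unitMeasure)
    (hθ : IsPruferAngle (primitive q) μ θ) (h0 : θ 0 = 0) {y : ℝ → ℝ}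
    (hy : IsEigenfunction q μ y) {x : ℝ} (hx : x ∈ Icc (0 : ℝ) 1) :
    y x = 0 ↔ Real.sin (θ x) = 0 := by
  obtain ⟨u, hu⟩ := hy.1.exists_isRegularized hq
  obtain ⟨r, hr, h⟩ := hy.exists_polar hq hθ h0 hu
  simp [(h x hx).1, hr x]

lemma isEigenvalue_iff (hq : Integrable q unitMeasure)
    (hθ : IsPruferAngle (primitive q) μ θ) (h0 : θ 0 = 0) :
    IsEigenvalue q μ ↔ ∃ k : ℕ, 0 < k ∧ θ 1 = k * Real.pi := by
  constructor
  · rintro ⟨y, hy⟩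
    exact exists_nat_of_sin_eq_zero (hθ.pos h0 (by simp))
      ((hy.eq_zero_iff hq hθ h0 (by simp)).1 hy.2.2.1)
  · rintro ⟨k, -, hk⟩
    obtain ⟨ρ, hρ0, hρ, hY⟩ := hθ.exists_isRegularized (primitive_continuousOn hq)
    refine ⟨_, hY.isSolution hq, by simp [h0], by simp [hk], ?_⟩
    -- If `sin θ` vanished identically, its derivative `cos θ · θ' = cos θ` would vanish as well.
    by_contra! hz
    have hzero : ∀ x ∈ Icc (0 : ℝ) 1, Real.sin (θ x) = 0 := fun x hx => by
      simpa [(hρ x).ne'] using hz x hx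
    have h1 : (1 / 2 : ℝ) ∈ Icc (0 : ℝ) 1 := by norm_num
    have d1 := ((hθ _ h1).hasDerivAt (Icc_mem_nhds (by norm_num) (by norm_num))).sin
    have d2 : HasDerivAt (fun x => Real.sin (θ x)) 0 (1 / 2 : ℝ) := by
      refine (hasDerivAt_const _ (0 : ℝ)).congr_of_eventuallyEq ?_
      filter_upwards [Icc_mem_nhds (by norm_num : (0 : ℝ) < 1 / 2) (by norm_num : (1 / 2 : ℝ) < 1)]
        with r hr
      exact hzero r hr
    have h3 := d1.unique d2
    rw [pruferField_of_sin_eq_zero (hzero _ h1), mul_one] at h3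
    have h4 := Real.sin_sq_add_cos_sq (θ (1 / 2))
    rw [hzero _ h1, h3] at h4
    norm_num at h4

/-- At the level `π / 2` the field equals `Q² + μ < 0`, so the angle cannot cross it upwards. This
supplies the lower end of the intermediate value argument in the spectral parameter. -/
lemma IsPruferAngle.lt_pi_div_two {Q : ℝ → ℝ} (hθ : IsPruferAngle Q μ θ) (h0 : θ 0 = 0)
    (hμ : ∀ x ∈ Icc (0 : ℝ) 1, Q x ^ 2 + μ < 0) : θ 1 < Real.pi / 2 := by
  have := Real.pi_pos
  have := pos_of_hasDerivWithinAt_pos_of_eq_zero (g := fun x => Real.pi / 2 - θ x) (a := 0) (b := 1)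
    (x := 1) (fun x hx => (hθ x hx).const_sub _) (by simp [h0]; positivity) (fun x hx h => by
      have h' : θ x = Real.pi / 2 := by linarith
      simp only [pruferField, h', Real.cos_pi_div_two, Real.sin_pi_div_two]
      have := hμ x hx
      linarith) (by simp)
  linarith

/-- Intermediate value theorem for `ν ↦ θ_ν(1)`, which lies below `π / 2` for very negative `ν` and
equals `kπ` at `ν = μ`. It shows that no index is skipped. -/
lemma IsPruferAngle.exists_lt {Q : ℝ → ℝ} (hQ : ContinuousOn Q (Icc 0 1))
    (hθ : IsPruferAngle Q μ θ) (h0 : θ 0 = 0) {k j : ℕ} (hk : θ 1 = k * Real.pi)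
    (hj : 0 < j) (hjk : j < k) :
    ∃ ν < μ, ∃ η : ℝ → ℝ, η 0 = 0 ∧ IsPruferAngle Q ν η ∧ η 1 = j * Real.pi := by
  choose Θ hΘ0 hΘ using fun ν => exists_isPruferAngle hQ ν 0
  have hcont : Continuous fun ν => Θ ν 1 := by
    rw [Metric.continuous_iff]
    intro ν ε hε
    obtain ⟨δ, hδ, h⟩ := (hΘ ν).exists_abs_sub_lt hQ hε
    refine ⟨δ, hδ, fun ν' hν' => ?_⟩
    rw [Real.dist_eq] at hν' ⊢
    exact h Q ν' (Θ ν') (hΘ ν') (by rw [hΘ0, hΘ0]) (fun x _ => by simpa using hδ.le) hν'.le 1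
      (by simp)
  obtain ⟨M, hM0, hM⟩ := exists_nonneg_bound hQ
  set ν₀ := min (-M ^ 2 - 1) μ
  have hπ := Real.pi_pos
  have hlow : Θ ν₀ 1 < Real.pi / 2 := (hΘ ν₀).lt_pi_div_two (hΘ0 ν₀) fun x hx => by
    have h1 : Q x ^ 2 ≤ M ^ 2 := sq_le_sq' (abs_le.1 (hM x hx)).1 (abs_le.1 (hM x hx)).2
    have h2 : ν₀ ≤ -M ^ 2 - 1 := min_le_left _ _
    linarith
  have hhigh : j * Real.pi < Θ μ 1 := by
    -- Uniqueness of the angle, from continuous dependence with the supposed gap as tolerance.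
    have : Θ μ 1 = θ 1 := by
      by_contra hne
      have h1 : 0 < |Θ μ 1 - θ 1| := abs_pos.2 (sub_ne_zero.2 hne)
      obtain ⟨δ, hδ, h⟩ := hθ.exists_abs_sub_lt hQ h1
      exact lt_irrefl _ (h Q μ (Θ μ) (hΘ μ) (by rw [hΘ0, h0]) (fun x _ => by simpa using hδ.le)
        (by simpa using hδ.le) 1 (by simp))
    rw [this, hk]
    gcongr
  have hj1 : (1 : ℝ) ≤ j := by exact_mod_cast hj
  obtain ⟨ν, hν, hνj⟩ := intermediate_value_Icc (min_le_right _ _ : ν₀ ≤ μ) hcont.continuousOn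
    (⟨by nlinarith, hhigh.le⟩ : j * Real.pi ∈ Icc (Θ ν₀ 1) (Θ μ 1))
  refine ⟨ν, lt_of_le_of_ne hν.2 ?_, Θ ν, hΘ0 ν, hΘ ν, hνj⟩
  rintro rfl
  simp only at hνj
  linarith

/-- Sturm oscillation: the index of an eigenvalue is read off the Prüfer angle at `1`. -/
lemma isNthEigenvalue_iff (hq : Integrable q unitMeasure)
    (hθ : IsPruferAngle (primitive q) μ θ) (h0 : θ 0 = 0) (m : ℕ) :
    IsNthEigenvalue q m μ ↔ 0 < m ∧ θ 1 = m * Real.pi := by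
  have hQ := primitive_continuousOn hq
  choose Θ hΘ0 hΘ using fun ν => exists_isPruferAngle hQ ν 0
  have key : ∀ k : ℕ, 0 < k → θ 1 = k * Real.pi →
      {ν : ℝ | IsEigenvalue q ν ∧ ν < μ}.encard + 1 = (k : ℕ∞) := by
    intro k hk0 hk
    have hsmall : ∀ ν < μ, Θ ν 1 < k * Real.pi := fun ν hν =>
      hk ▸ (hΘ ν).lt_of_lt hQ hθ (by rw [hΘ0, h0]) hν (by simp)
    refine encard_add_one_eq (f := fun ν => Θ ν 1) hk0 ?_ ?_ ?_
    · have hmono : StrictMono fun ν => Θ ν 1 := fun ν ν' h =>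
        (hΘ ν).lt_of_lt hQ (hΘ ν') (by rw [hΘ0, hΘ0]) h (by simp)
      exact hmono.injective.injOn
    · rintro ν ⟨hν, hνμ⟩
      obtain ⟨j, hj0, hj⟩ := (isEigenvalue_iff hq (hΘ ν) (hΘ0 ν)).1 hν
      refine ⟨j, hj0, ?_, hj⟩
      have h1 := hsmall ν hνμ
      rw [hj] at h1
      exact_mod_cast lt_of_mul_lt_mul_right h1 Real.pi_pos.le
    · intro j hj0 hjk
      obtain ⟨ν, hν, η, hη0, hη, hηj⟩ := hθ.exists_lt hQ h0 hk hj0 hjk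
      have he : IsEigenvalue q ν := (isEigenvalue_iff hq hη hη0).2 ⟨j, hj0, hηj⟩
      refine ⟨ν, ⟨he, hν⟩, ?_⟩
      by_contra hne
      have h1 : 0 < |Θ ν 1 - j * Real.pi| := abs_pos.2 (sub_ne_zero.2 hne)
      obtain ⟨δ, hδ, h⟩ := hη.exists_abs_sub_lt hQ h1
      have h2 := h _ ν (Θ ν) (hΘ ν) (by rw [hΘ0, hη0]) (fun x _ => by simpa using hδ.le)
        (by simpa using hδ.le) 1 (by simp)
      rw [hηj] at h2
      exact lt_irrefl _ h2
  constructor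
  · rintro ⟨he, hcard⟩
    obtain ⟨k, hk0, hk⟩ := (isEigenvalue_iff hq hθ h0).1 he
    have : (k : ℕ∞) = m := (key k hk0 hk).symm.trans hcard
    have hkm : k = m := by exact_mod_cast this
    exact hkm ▸ ⟨hk0, hk⟩
  · rintro ⟨hm, hm1⟩
    exact ⟨(isEigenvalue_iff hq hθ h0).2 ⟨m, hm, hm1⟩, key m hm hm1⟩

lemma IsEigenfunction.encard_zeros (hq : Integrable q unitMeasure)
    (hθ : IsPruferAngle (primitive q) μ θ) (h0 : θ 0 = 0) {y : ℝ → ℝ}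
    (hy : IsEigenfunction q μ y) {T : ℝ} (hT : T ∈ Ioo (0 : ℝ) 1) {k : ℕ} (hk0 : 0 < k)
    (hk : θ T = k * Real.pi) :
    {x : ℝ | x ∈ Ioo (0 : ℝ) 1 ∧ y x = 0 ∧ x < T}.encard + 1 = (k : ℕ∞) := by
  rw [← hθ.encard_zeros h0 hk0 (Ioo_subset_Icc_self hT) hk]
  congr 2
  ext x
  constructor
  · rintro ⟨hx, hyx, hxT⟩
    exact ⟨⟨hx.1, hxT⟩, (hy.eq_zero_iff hq hθ h0 (Ioo_subset_Icc_self hx)).1 hyx⟩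
  · rintro ⟨hx, hyx⟩
    have hx1 : x ∈ Ioo (0 : ℝ) 1 := ⟨hx.1, hx.2.trans hT.2⟩
    exact ⟨hx1, (hy.eq_zero_iff hq hθ h0 (Ioo_subset_Icc_self hx1)).2 hyx, hx.2⟩

lemma IsEigenfunction.isNode (hq : Integrable q unitMeasure)
    (hθ : IsPruferAngle (primitive q) μ θ) (h0 : θ 0 = 0) {y : ℝ → ℝ}
    (hy : IsEigenfunction q μ y) {T : ℝ} (hT : T ∈ Ioo (0 : ℝ) 1) {i m : ℕ}
    (hi : θ T = i * Real.pi) (hm : θ 1 = m * Real.pi) : IsNode q i m T := by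
  have hpos : ∀ {k : ℕ} {x : ℝ}, x ∈ Ioc (0 : ℝ) 1 → θ x = k * Real.pi → 0 < k := by
    intro k x hx hk
    rcases Nat.eq_zero_or_pos k with rfl | h
    · have := hθ.pos h0 hx
      simp [hk] at this
    · exact h
  refine ⟨μ, y, ⟨(isNthEigenvalue_iff hq hθ h0 m).2 ⟨hpos (by simp) hm, hm⟩, hy⟩, hT, ?_,
    hy.encard_zeros hq hθ h0 hT (hpos ⟨hT.1, hT.2.le⟩ hi) hi⟩
  rw [hy.eq_zero_iff hq hθ h0 (Ioo_subset_Icc_self hT), hi]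
  exact Real.sin_nat_mul_pi i

/-- The eigenpair hidden in `IsNode` may be replaced by any given one: strict monotonicity in the
spectral parameter makes the `m`-th eigenvalue unique, and the number of zeros before `T` identifies
the multiple of `π`. -/
lemma IsNode.pruferAngle_eq (hq : Integrable q unitMeasure)
    (hθ : IsPruferAngle (primitive q) μ θ) (h0 : θ 0 = 0) {m i : ℕ} {T : ℝ}
    (hnode : IsNode q i m T) (hμ : IsNthEigenvalue q m μ) :
    θ T = i * Real.pi ∧ θ 1 = m * Real.pi := by
  have hQ := primitive_continuousOn hq
  obtain ⟨ν, E, ⟨hν, hE⟩, hT, hET, hcard⟩ := hnode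
  have hm := ((isNthEigenvalue_iff hq hθ h0 m).1 hμ).2
  refine ⟨?_, hm⟩
  obtain ⟨η, hη0, hη⟩ := exists_isPruferAngle hQ ν 0
  have hm' := ((isNthEigenvalue_iff hq hη hη0 m).1 hν).2
  have hνμ : ν = μ := by
    rcases lt_trichotomy ν μ with h | h | h
    · have := hη.lt_of_lt hQ hθ (by rw [hη0, h0]) h (x := 1) (by simp)
      linarith
    · exact h
    · have := hθ.lt_of_lt hQ hη (by rw [hη0, h0]) h (x := 1) (by simp)
      linarith
  subst hνμ
  obtain ⟨k, hk0, hk⟩ := exists_nat_of_sin_eq_zero (hθ.pos h0 ⟨hT.1, hT.2.le⟩)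
    ((hE.eq_zero_iff hq hθ h0 (Ioo_subset_Icc_self hT)).1 hET)
  have h1 : (k : ℕ∞) = i := (hE.encard_zeros hq hθ h0 hT hk0 hk).symm.trans hcard
  have h2 : k = i := by exact_mod_cast h1
  rw [hk, h2]

end Eigenvalues

/-! ### Sturm comparison with constant potentials -/

section Comparison

variable {q : ℝ → ℝ} {μ κ : ℝ}

lemma pos_or_neg_of_ne_zero_Ioo {f : ℝ → ℝ} {α β : ℝ} (hf : ContinuousOn f (Ioo α β))
    (h : ∀ x ∈ Ioo α β, f x ≠ 0) :
    (∀ x ∈ Ioo α β, 0 < f x) ∨ (∀ x ∈ Ioo α β, f x < 0) := by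
  by_contra! hcon
  obtain ⟨⟨x, hx, hfx⟩, ⟨x', hx', hfx'⟩⟩ := hcon
  obtain ⟨t, ht, hft⟩ := isPreconnected_Ioo.intermediate_value hx hx' hf ⟨hfx, hfx'⟩
  exact h t ht hft

/-- Comparison of a nodal domain with the sine function, for a one-sided bounded potential. -/
lemma IsSolution.comparison_of_pos {y : ℝ → ℝ}
    (hy : IsSolution q μ y) {α β : ℝ} (hα : 0 ≤ α) (hαβ : α < β) (hβ : β ≤ 1) (hyα : y α = 0)
    (hyβ : y β = 0) (hpos : ∀ x ∈ Ioo α β, 0 < y x) {σ : ℝ}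
    (hσ : ∀ᵐ x, x ∈ Ioo α β → 0 ≤ σ * (q x - κ)) :
    0 ≤ σ * (μ - κ - (Real.pi / (β - α)) ^ 2) := by
  by_contra! hneg
  set ω := Real.pi / (β - α) with hω
  have hωpos : 0 < ω := div_pos Real.pi_pos (sub_pos.2 hαβ)
  have hωβ : ω * (β - α) = Real.pi := div_mul_cancel₀ _ (sub_pos.2 hαβ).ne'
  obtain ⟨z, hyz, hz, hzy⟩ := hy
  have hsub : Icc α β ⊆ Icc (0 : ℝ) 1 := Icc_subset_Icc hα hβ
  have hyc : ContinuousOn y (Icc α β) :=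
    fun x hx => ((hyz x (hsub hx)).continuousWithinAt).mono hsub
  have hzac : AbsolutelyContinuousOnInterval z α β := hz.mono (by
    rwa [uIcc_of_le hαβ.le, uIcc_of_le zero_le_one])
  have hzc : ContinuousOn z (Icc α β) := by
    have := hzac.continuousOn
    rwa [uIcc_of_le hαβ.le] at this
  have hyz' : ∀ x ∈ Icc α β, HasDerivWithinAt y (z x) (Icc α β) x :=
    fun x hx => (hyz x (hsub hx)).mono hsub
  have hSd : ∀ x, HasDerivAt (fun x => Real.sin (ω * (x - α))) (ω * Real.cos (ω * (x - α))) x := by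
    intro x
    convert! (((hasDerivAt_id x).sub_const α).const_mul ω).sin using 1
    simp; ring
  have hCd : ∀ x, HasDerivAt (fun x => ω * Real.cos (ω * (x - α)))
      (-ω ^ 2 * Real.sin (ω * (x - α))) x := by
    intro x
    convert! ((((hasDerivAt_id x).sub_const α).const_mul ω).cos).const_mul ω using 1
    simp; ring
  have hyac := absolutelyContinuousOnInterval_of_hasDerivWithinAt hαβ.le hzc hyz'
  have hSac := absolutelyContinuousOnInterval_of_hasDerivWithinAt hαβ.le (by fun_prop)
    (fun x _ => (hSd x).hasDerivWithinAt)
  have hCac := absolutelyContinuousOnInterval_of_hasDerivWithinAt hαβ.le (by fun_prop)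
    (fun x _ => (hCd x).hasDerivWithinAt)
  -- With `S = sin (ω (x - α))`, the function `y' S - y S'` vanishes at both ends and has derivative
  -- `(q - μ + ω²) y S` almost everywhere. If the claim failed, `σ` times this derivative would be
  -- at least `d y S` with `d > 0`, contradicting its zero integral.
  have hWac := (hzac.fun_mul hSac).fun_sub (hyac.fun_mul hCac)
  have hint := hWac.integral_deriv_eq_sub
  have hend : Real.sin (ω * (β - α)) = 0 := by rw [hωβ, Real.sin_pi]
  simp only [hyα, hyβ, hend, sub_self, mul_zero, Real.sin_zero, zero_mul] at hint
  rw [ae_unitMeasure_iff] at hzy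
  have hαne : ∀ᵐ x : ℝ, x ≠ α := by simp [ae_iff, measure_singleton]
  have hβne : ∀ᵐ x : ℝ, x ≠ β := by simp [ae_iff, measure_singleton]
  have hS : ∀ x ∈ Ioo α β, 0 < Real.sin (ω * (x - α)) := fun x hx => by
    refine Real.sin_pos_of_pos_of_lt_pi (mul_pos hωpos (sub_pos.2 hx.1)) ?_
    rw [← hωβ]
    have := hx.2
    gcongr
  set d := -(σ * (μ - κ - ω ^ 2)) with hd
  have hlower : ∫ x in α..β, d * (y x * Real.sin (ω * (x - α))) ≤
      ∫ x in α..β, σ * deriv (fun x => z x * Real.sin (ω * (x - α)) -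
        y x * (ω * Real.cos (ω * (x - α)))) x := by
    refine intervalIntegral.integral_mono_ae_restrict hαβ.le
      (ContinuousOn.intervalIntegrable_of_Icc hαβ.le (by fun_prop))
      (hWac.intervalIntegrable_deriv.const_mul σ) ?_
    rw [Filter.EventuallyLE, ae_restrict_iff' measurableSet_Icc]
    filter_upwards [hσ, hzy, ae_hasDerivAt_of_hasDerivWithinAt hyz', hαne, hβne]
      with x h1 h2 h3 h4 h5 hx
    have hxo : x ∈ Ioo α β := ⟨lt_of_le_of_ne hx.1 (Ne.symm h4), lt_of_le_of_ne hx.2 h5⟩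
    have hder := ((h2 (hsub hx)).mul (hSd x)).sub ((h3 hx).mul (hCd x))
    have hder' : deriv (fun x => z x * Real.sin (ω * (x - α)) -
        y x * (ω * Real.cos (ω * (x - α)))) x =
        (q x - μ + ω ^ 2) * (y x * Real.sin (ω * (x - α))) := by
      refine Eq.trans hder.deriv ?_
      ring
    rw [hder', ← mul_assoc σ]
    refine mul_le_mul_of_nonneg_right ?_ (mul_pos (hpos x hxo) (hS x hxo)).le
    have := h1 hxo
    linarith
  rw [intervalIntegral.integral_const_mul σ, hint, mul_zero] at hlower
  have hposint : 0 < ∫ x in α..β, d * (y x * Real.sin (ω * (x - α))) :=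
    intervalIntegral.intervalIntegral_pos_of_pos_on
      (ContinuousOn.intervalIntegrable_of_Icc hαβ.le (by fun_prop))
      (fun x hx => mul_pos (by linarith) (mul_pos (hpos x hx) (hS x hx))) hαβ
  linarith

lemma IsSolution.neg {y : ℝ → ℝ} (hy : IsSolution q μ y) : IsSolution q μ (fun x => -y x) := by
  obtain ⟨z, h1, h2, h3⟩ := hy
  refine ⟨fun x => -z x, fun x hx => (h1 x hx).neg, h2.fun_neg, ?_⟩
  filter_upwards [h3] with x hx
  convert! hx.neg using 1
  ring

lemma IsSolution.comparison {y : ℝ → ℝ}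
    (hy : IsSolution q μ y) {α β : ℝ} (hα : 0 ≤ α) (hαβ : α < β) (hβ : β ≤ 1) (hyα : y α = 0)
    (hyβ : y β = 0) (hne : ∀ x ∈ Ioo α β, y x ≠ 0) {σ : ℝ}
    (hσ : ∀ᵐ x, x ∈ Ioo α β → 0 ≤ σ * (q x - κ)) :
    0 ≤ σ * (μ - κ - (Real.pi / (β - α)) ^ 2) := by
  have hyc : ContinuousOn y (Ioo α β) := by
    obtain ⟨z, h1, -, -⟩ := hy
    exact fun x hx => ((h1 x ⟨hα.trans hx.1.le, hx.2.le.trans hβ⟩).continuousWithinAt).mono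
      (Ioo_subset_Icc_self.trans (Icc_subset_Icc hα hβ))
  rcases pos_or_neg_of_ne_zero_Ioo hyc hne with h | h
  · exact hy.comparison_of_pos hα hαβ hβ hyα hyβ h hσ
  · exact hy.neg.comparison_of_pos hα hαβ hβ (by simp [hyα]) (by simp [hyβ])
      (fun x hx => by simpa using h x hx) hσ

/-- The subintervals of a Prüfer angle between consecutive multiples of `π` are nodal domains. -/
lemma IsEigenfunction.exists_nodal_partition (hq : Integrable q unitMeasure) {θ : ℝ → ℝ}
    (hθ : IsPruferAngle (primitive q) μ θ) (h0 : θ 0 = 0) {y : ℝ → ℝ}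
    (hy : IsEigenfunction q μ y) {A B : ℝ} (hA : 0 ≤ A) (hAB : A < B) (hB : B ≤ 1) {j n : ℕ}
    (hθA : θ A = j * Real.pi) (hθB : θ B = ((j + n : ℕ) : ℝ) * Real.pi) :
    ∃ c : ℕ → ℝ, c 0 = A ∧ c n = B ∧ ∀ l < n, A ≤ c l ∧ c l < c (l + 1) ∧ c (l + 1) ≤ B ∧
      y (c l) = 0 ∧ y (c (l + 1)) = 0 ∧ ∀ x ∈ Ioo (c l) (c (l + 1)), y x ≠ 0 := by
  have hB0 : B ∈ Icc (0 : ℝ) 1 := ⟨hA.trans hAB.le, hB⟩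
  have hA0 : A ∈ Icc (0 : ℝ) 1 := ⟨hA, hAB.le.trans hB⟩
  have hex : ∀ l, ∃ t, l ≤ n → t ∈ Icc 0 B ∧ θ t = ((j + l : ℕ) : ℝ) * Real.pi := by
    intro l
    by_cases hl : l ≤ n
    · obtain ⟨t, ht, htl⟩ := hθ.exists_eq_nat_mul_pi h0 hB0 hθB (by omega : j + l ≤ j + n)
      exact ⟨t, fun _ => ⟨ht, htl⟩⟩
    · exact ⟨0, fun h => absurd h hl⟩
  choose c hc using hex
  have hcI : ∀ l ≤ n, c l ∈ Icc (0 : ℝ) 1 := fun l hl =>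
    ⟨(hc l hl).1.1, (hc l hl).1.2.trans hB⟩
  have hc0 : c 0 = A := hθ.eq_of_eq_nat_mul_pi (hcI 0 (Nat.zero_le _)) hA0
    (hc 0 (Nat.zero_le _)).2 hθA
  have hcn : c n = B := hθ.eq_of_eq_nat_mul_pi (hcI n le_rfl) hB0 (hc n le_rfl).2 hθB
  have hzero : ∀ l ≤ n, y (c l) = 0 := fun l hl => by
    rw [hy.eq_zero_iff hq hθ h0 (hcI l hl), (hc l hl).2]
    exact Real.sin_nat_mul_pi _
  refine ⟨c, hc0, hcn, fun l hl => ⟨?_, ?_, (hc (l + 1) hl).1.2, hzero l hl.le, hzero (l + 1) hl,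
    fun x hx hyx => ?_⟩⟩
  · rcases Nat.eq_zero_or_pos l with rfl | h
    · exact hc0.ge
    · exact (hθ.lt_of_eq_nat_mul_pi (by omega : j < j + l) hA0.2 (hcI l hl.le).1 hθA
        (hc l hl.le).2).le
  · exact hθ.lt_of_eq_nat_mul_pi (by omega : j + l < j + (l + 1)) (hcI l hl.le).2
      (hcI (l + 1) hl).1 (hc l hl.le).2 (hc (l + 1) hl).2
  · have hx0 : 0 < x := (hcI l hl.le).1.trans_lt hx.1
    have hx1 : x ≤ 1 := hx.2.le.trans (hcI (l + 1) hl).2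
    obtain ⟨k, -, hk⟩ := exists_nat_of_sin_eq_zero (hθ.pos h0 ⟨hx0, hx1⟩)
      ((hy.eq_zero_iff hq hθ h0 ⟨hx0.le, hx1⟩).1 hyx)
    have h1 := hθ.nat_mul_pi_lt (hcI l hl.le).1 (hc l hl.le).2.ge hx.1 hx1
    have h2 := hθ.nat_mul_pi_lt hx0.le hk.ge hx.2 (hcI (l + 1) hl).2
    rw [hk] at h1
    rw [(hc (l + 1) hl).2] at h2
    have h3 := lt_of_mul_lt_mul_right h1 Real.pi_pos.le
    have h4 := lt_of_mul_lt_mul_right h2 Real.pi_pos.le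
    have h5 : j + l < k := by exact_mod_cast h3
    have h6 : k < j + (l + 1) := by exact_mod_cast h4
    omega

/-- Spectral comparison on an interval carrying `n` nodal domains, for potentials above `κ`. -/
lemma IsEigenfunction.sq_le_of_le (hq : Integrable q unitMeasure) {θ : ℝ → ℝ}
    (hθ : IsPruferAngle (primitive q) μ θ) (h0 : θ 0 = 0) {y : ℝ → ℝ}
    (hy : IsEigenfunction q μ y) {A B : ℝ} (hA : 0 ≤ A) (hAB : A < B) (hB : B ≤ 1) {j n : ℕ}
    (hn : 0 < n) (hθA : θ A = j * Real.pi) (hθB : θ B = ((j + n : ℕ) : ℝ) * Real.pi)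
    (hκ : ∀ᵐ x, x ∈ Ioo A B → κ ≤ q x) : (n * Real.pi / (B - A)) ^ 2 ≤ μ - κ := by
  obtain ⟨c, hc0, hcn, hc⟩ := hy.exists_nodal_partition hq hθ h0 hA hAB hB hθA hθB
  -- Some nodal interval is no longer than the average `(B - A) / n`; for a lower bound on `μ` a
  -- short interval is the useful one.
  obtain ⟨l, hl, hle⟩ := Finset.exists_le_of_sum_le (s := Finset.range n)
    (f := fun l => c (l + 1) - c l) (g := fun _ => (B - A) / n) ⟨0, by simpa using hn⟩ (by
      rw [Finset.sum_range_sub, hc0, hcn, Finset.sum_const, Finset.card_range, nsmul_eq_mul,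
        mul_div_cancel₀ _ (by exact_mod_cast hn.ne')])
  obtain ⟨h1, h2, h3, h4, h5, h6⟩ := hc l (by simpa using hl)
  have key := hy.1.comparison (κ := κ) (hA.trans h1) h2 (h3.trans hB) h4 h5 h6 (σ := 1) (by
    filter_upwards [hκ] with x hx hxI
    have := hx ⟨h1.trans_lt hxI.1, hxI.2.trans_le h3⟩
    linarith)
  have h7 : 0 < c (l + 1) - c l := sub_pos.2 h2
  have h8 : 0 < B - A := sub_pos.2 hAB
  have h9 : n * Real.pi / (B - A) ≤ Real.pi / (c (l + 1) - c l) := by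
    have hπ := Real.pi_pos
    have hn' : (0 : ℝ) < n := by exact_mod_cast hn
    simp only [le_div_iff₀ hn'] at hle
    rw [div_le_div_iff₀ h8 h7]
    nlinarith
  have h10 : (n * Real.pi / (B - A)) ^ 2 ≤ (Real.pi / (c (l + 1) - c l)) ^ 2 := by
    have hπ := Real.pi_pos
    gcongr
  linarith

/-- Spectral comparison on an interval carrying `n` nodal domains, for potentials below `κ`. -/
lemma IsEigenfunction.le_sq_of_le (hq : Integrable q unitMeasure) {θ : ℝ → ℝ}
    (hθ : IsPruferAngle (primitive q) μ θ) (h0 : θ 0 = 0) {y : ℝ → ℝ}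
    (hy : IsEigenfunction q μ y) {A B : ℝ} (hA : 0 ≤ A) (hAB : A < B) (hB : B ≤ 1) {j n : ℕ}
    (hn : 0 < n) (hθA : θ A = j * Real.pi) (hθB : θ B = ((j + n : ℕ) : ℝ) * Real.pi)
    (hκ : ∀ᵐ x, x ∈ Ioo A B → q x ≤ κ) : μ - κ ≤ (n * Real.pi / (B - A)) ^ 2 := by
  obtain ⟨c, hc0, hcn, hc⟩ := hy.exists_nodal_partition hq hθ h0 hA hAB hB hθA hθB
  -- For an upper bound on `μ`, a nodal interval at least as long as the average is used.
  obtain ⟨l, hl, hle⟩ := Finset.exists_le_of_sum_le (s := Finset.range n)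
    (f := fun _ => (B - A) / n) (g := fun l => c (l + 1) - c l) ⟨0, by simpa using hn⟩ (by
      rw [Finset.sum_range_sub, hc0, hcn, Finset.sum_const, Finset.card_range, nsmul_eq_mul,
        mul_div_cancel₀ _ (by exact_mod_cast hn.ne')])
  obtain ⟨h1, h2, h3, h4, h5, h6⟩ := hc l (by simpa using hl)
  have key := hy.1.comparison (κ := κ) (hA.trans h1) h2 (h3.trans hB) h4 h5 h6 (σ := -1) (by
    filter_upwards [hκ] with x hx hxI
    have := hx ⟨h1.trans_lt hxI.1, hxI.2.trans_le h3⟩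
    linarith)
  have h7 : 0 < c (l + 1) - c l := sub_pos.2 h2
  have h8 : 0 < B - A := sub_pos.2 hAB
  have h9 : Real.pi / (c (l + 1) - c l) ≤ n * Real.pi / (B - A) := by
    have hπ := Real.pi_pos
    have hn' : (0 : ℝ) < n := by exact_mod_cast hn
    simp only [div_le_iff₀ hn'] at hle
    rw [div_le_div_iff₀ h7 h8]
    nlinarith
  have h10 : (Real.pi / (c (l + 1) - c l)) ^ 2 ≤ (n * Real.pi / (B - A)) ^ 2 := by
    have hπ := Real.pi_pos
    gcongr
  linarith

lemma div_le_of_sq_div_le {T π : ℝ} (hT : T ∈ Ioo (0 : ℝ) 1) (hπ : 0 < π) {i m : ℕ} (him : i < m)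
    (h : (i * π / T) ^ 2 ≤ (((m - i : ℕ) : ℝ) * π / (1 - T)) ^ 2) : (i : ℝ) / m ≤ T := by
  have h1 : 0 < 1 - T := sub_pos.2 hT.2
  have hm : (0 : ℝ) < m := by exact_mod_cast (Nat.zero_le i).trans_lt him
  have h2 := (sq_le_sq₀ (by have := hT.1; positivity) (by positivity)).1 h
  rw [div_le_div_iff₀ hT.1 h1, Nat.cast_sub him.le] at h2
  rw [div_le_iff₀ hm]
  have : π * (i * (1 - T)) ≤ π * ((m - i) * T) := by linarith
  have := le_of_mul_le_mul_left this hπ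
  linarith

lemma le_div_of_sq_div_le {T π : ℝ} (hT : T ∈ Ioo (0 : ℝ) 1) (hπ : 0 < π) {i m : ℕ} (him : i < m)
    (h : (((m - i : ℕ) : ℝ) * π / (1 - T)) ^ 2 ≤ (i * π / T) ^ 2) : T ≤ (i : ℝ) / m := by
  have h1 : 0 < 1 - T := sub_pos.2 hT.2
  have hm : (0 : ℝ) < m := by exact_mod_cast (Nat.zero_le i).trans_lt him
  have h2 := (sq_le_sq₀ (by positivity) (by have := hT.1; positivity)).1 h
  rw [div_le_div_iff₀ h1 hT.1, Nat.cast_sub him.le] at h2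
  rw [le_div_iff₀ hm]
  have : π * ((m - i) * T) ≤ π * (i * (1 - T)) := by linarith
  have := le_of_mul_le_mul_left this hπ
  linarith

/-- A potential above `κ` to the left of the node and below `κ` to its right pushes the node to
the right of the node of the constant potential. -/
lemma IsNode.div_le_of_le_of_le (hq : Integrable q unitMeasure) {i m : ℕ} (hi : 1 ≤ i)
    (him : i < m) {T : ℝ} (hnode : IsNode q i m T) (hl : ∀ᵐ x, x ∈ Ioo 0 T → κ ≤ q x)
    (hr : ∀ᵐ x, x ∈ Ioo T 1 → q x ≤ κ) : (i : ℝ) / m ≤ T := by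
  obtain ⟨μ, y, ⟨hμ, hy⟩, hT, -⟩ := id hnode
  obtain ⟨θ, h0, hθ⟩ := exists_isPruferAngle (primitive_continuousOn hq) μ 0
  obtain ⟨hθT, hθ1⟩ := hnode.pruferAngle_eq hq hθ h0 hμ
  have h1 := hy.sq_le_of_le hq hθ h0 le_rfl hT.1 hT.2.le hi (j := 0) (by simp [h0])
    (by simpa using hθT) hl
  have h2 := hy.le_sq_of_le hq hθ h0 hT.1.le hT.2 le_rfl (Nat.sub_pos_of_lt him) hθT
    (by rw [hθ1, Nat.add_sub_cancel' him.le]) hr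
  rw [sub_zero] at h1
  exact div_le_of_sq_div_le hT Real.pi_pos him (h1.trans h2)

/-- A potential below `κ` to the left of the node and above `κ` to its right pushes the node to
the left of the node of the constant potential. -/
lemma IsNode.le_div_of_le_of_le (hq : Integrable q unitMeasure) {i m : ℕ} (hi : 1 ≤ i)
    (him : i < m) {T : ℝ} (hnode : IsNode q i m T) (hl : ∀ᵐ x, x ∈ Ioo 0 T → q x ≤ κ)
    (hr : ∀ᵐ x, x ∈ Ioo T 1 → κ ≤ q x) : T ≤ (i : ℝ) / m := by
  obtain ⟨μ, y, ⟨hμ, hy⟩, hT, -⟩ := id hnode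
  obtain ⟨θ, h0, hθ⟩ := exists_isPruferAngle (primitive_continuousOn hq) μ 0
  obtain ⟨hθT, hθ1⟩ := hnode.pruferAngle_eq hq hθ h0 hμ
  have h1 := hy.le_sq_of_le hq hθ h0 le_rfl hT.1 hT.2.le hi (j := 0) (by simp [h0])
    (by simpa using hθT) hl
  have h2 := hy.sq_le_of_le hq hθ h0 hT.1.le hT.2 le_rfl (Nat.sub_pos_of_lt him) hθT
    (by rw [hθ1, Nat.add_sub_cancel' him.le]) hr
  rw [sub_zero] at h1
  exact le_div_of_sq_div_le hT Real.pi_pos him (h2.trans h1)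

end Comparison

/-! ### Admissible perturbations of a potential with prescribed node -/

section Perturbation

variable {q : ℝ → ℝ} {μ : ℝ}

/-- Solvability of the linearized equation `-w'' + q w = μ w - h E` with zeros prescribed
at `0`, `T` and `1`. -/
lemma IsEigenfunction.exists_linearization (hq : Integrable q unitMeasure) {E : ℝ → ℝ}
    (hE : IsEigenfunction q μ E) {T : ℝ} (hET : E T = 0) {h : ℝ → ℝ}
    (hh : ContinuousOn h (Icc 0 1)) (hhT : ∫ x in (0 : ℝ)..T, h x * E x ^ 2 = 0)
    (hh1 : ∫ x in (0 : ℝ)..1, h x * E x ^ 2 = 0) :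
    ∃ w ζ : ℝ → ℝ, (∀ x ∈ Icc (0 : ℝ) 1, HasDerivWithinAt w (ζ x) (Icc 0 1) x) ∧
      AbsolutelyContinuousOnInterval ζ 0 1 ∧
      (∀ᵐ x ∂unitMeasure, HasDerivAt ζ ((q x - μ) * w x + h x * E x) x) ∧
      w 0 = 0 ∧ w T = 0 ∧ w 1 = 0 := by
  have hQ := primitive_continuousOn hq
  obtain ⟨u, hu⟩ := hE.1.exists_isRegularized hq
  obtain ⟨θ, hθ0, hθ⟩ := exists_isPruferAngle hQ μ (Real.pi / 2)
  obtain ⟨ρ, hρ0, -, hF⟩ := hθ.exists_isRegularized hQ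
  obtain ⟨η, hη0, hη⟩ := exists_isPruferAngle hQ μ 0
  obtain ⟨σ, hσ0, -, hY⟩ := hη.exists_isRegularized hQ
  have hu0 : u 0 ≠ 0 := hu.quasiderivative_ne_zero hq hY hE.2.1 (by simp [hη0])
    (by simp [hη0, hσ0]) hE.2.2.2
  set F := fun x => ρ x * Real.sin (θ x) with hFdef
  set v := fun x => ρ x * Real.cos (θ x) with hvdef
  have hF0 : F 0 = 1 := by simp [hFdef, hθ0, hρ0]
  have hv0 : v 0 = 0 := by simp [hvdef, hθ0]
  have hW : ∀ x ∈ Icc (0 : ℝ) 1, E x * v x - u x * F x = -u 0 := fun x hx => by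
    rw [hu.wronskian_eq hF hx, hF0, hv0, hE.2.1]; ring
  obtain ⟨hE1, hE2, hE3⟩ := hu.isSolution_aux hq
  obtain ⟨hF1, hF2, hF3⟩ := hF.isSolution_aux hq
  obtain ⟨hEc, huc⟩ := hu.continuousOn
  obtain ⟨hFc, hvc⟩ := hF.continuousOn
  clear_value F v
  set I := fun x => ∫ t in (0 : ℝ)..x, h t * E t ^ 2 with hI
  set J := fun x => ∫ t in (0 : ℝ)..x, h t * E t * F t with hJ
  have hId : ∀ x ∈ Icc (0 : ℝ) 1, HasDerivWithinAt I (h x * E x ^ 2) (Icc 0 1) x := fun x hx =>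
    hasDerivWithinAt_integral_of_continuousOn (g := fun t => h t * E t ^ 2) (by fun_prop) hx
  have hJd : ∀ x ∈ Icc (0 : ℝ) 1, HasDerivWithinAt J (h x * E x * F x) (Icc 0 1) x := fun x hx =>
    hasDerivWithinAt_integral_of_continuousOn (g := fun t => h t * E t * F t) (by fun_prop) hx
  have hI0 : I 0 = 0 := by simp [hI]
  have hJ0 : J 0 = 0 := by simp [hJ]
  have hIT : I T = 0 := hhT
  have hI1 : I 1 = 0 := hh1
  clear_value I J
  have hIac := absolutelyContinuousOnInterval_of_hasDerivWithinAt zero_le_one (by fun_prop) hId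
  have hJac := absolutelyContinuousOnInterval_of_hasDerivWithinAt zero_le_one (by fun_prop) hJd
  -- Variation of constants in the basis `E`, `F`, whose Wronskian is `-u 0`. At a zero of `E` the
  -- solution reduces to a multiple of `F I`, and the orthogonality conditions say that `I` vanishes
  -- at `T` and `1`.
  refine ⟨fun x => (-(u 0)⁻¹) * (F x * I x - E x * J x),
    fun x => (-(u 0)⁻¹) * ((v x + primitive q x * F x) * I x - (u x + primitive q x * E x) * J x),
    fun x hx => ?_, ?_, ?_, ?_, ?_, ?_⟩
  · convert! (((hF1 x hx).mul (hId x hx)).sub ((hE1 x hx).mul (hJd x hx))).const_mul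
      (-(u 0)⁻¹) using 1
    ring
  · exact ((hF2.fun_mul hIac).fun_sub (hE2.fun_mul hJac)).const_mul _
  · rw [ae_unitMeasure_iff] at hE3 hF3 ⊢
    filter_upwards [hE3, hF3, ae_hasDerivAt_of_hasDerivWithinAt hId,
      ae_hasDerivAt_of_hasDerivWithinAt hJd] with x h1 h2 h3 h4 hx
    convert! ((((h2 hx).mul (h3 hx)).sub ((h1 hx).mul (h4 hx))).const_mul (-(u 0)⁻¹)) using 1
    have hWx := hW x hx
    have hinv : (u 0)⁻¹ * u 0 = 1 := inv_mul_cancel₀ hu0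
    linear_combination (u 0)⁻¹ * (h x * E x) * hWx - (h x * E x) * hinv
  · simp [hI0, hJ0]
  · simp [hIT, hET]
  · simp [hI1, hE.2.2.1]

/-- Close Prüfer angles that are both multiples of `π` coincide. -/
lemma eq_nat_mul_pi_of_abs_sub_lt {t : ℝ} {k : ℕ} (ht : Real.sin t = 0)
    (h : |t - k * Real.pi| < Real.pi) : t = k * Real.pi := by
  obtain ⟨n, hn⟩ := Real.sin_eq_zero_iff.1 ht
  have h1 : |((n - k : ℤ) : ℝ)| * Real.pi < 1 * Real.pi := by
    calc |((n - k : ℤ) : ℝ)| * Real.pi = |((n - k : ℤ) : ℝ) * Real.pi| := by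
          rw [abs_mul, abs_of_pos Real.pi_pos]
      _ = |t - k * Real.pi| := by rw [← hn]; push_cast; ring_nf
      _ < 1 * Real.pi := by simpa using h
  have h2 := lt_of_mul_lt_mul_right h1 Real.pi_pos.le
  have h3 : |n - (k : ℤ)| < 1 := by exact_mod_cast h2
  have h4 : n - (k : ℤ) = 0 := Int.abs_lt_one_iff.1 h3
  have h5 : n = k := by omega
  rw [← hn, h5]; simp

/-- Potentials close to `q` having an eigenfunction with zeros at `0`, `T`, `1` for the same `μ`
have the same node. -/
lemma exists_isNode_of_abs_le (hq : Integrable q unitMeasure) {θ : ℝ → ℝ}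
    (hθ : IsPruferAngle (primitive q) μ θ) (h0 : θ 0 = 0) {T : ℝ} (hT : T ∈ Ioo (0 : ℝ) 1)
    {i m : ℕ} (hi : θ T = i * Real.pi) (hm : θ 1 = m * Real.pi) :
    ∃ δ > 0, ∀ (g : ℝ → ℝ) (y : ℝ → ℝ), Integrable g unitMeasure →
      (∀ x ∈ Icc (0 : ℝ) 1, |g x| ≤ δ) → IsEigenfunction (fun x => q x + g x) μ y → y T = 0 →
      IsNode (fun x => q x + g x) i m T := by
  -- Tolerance `π` suffices: the perturbed angles at `T` and `1` are multiples of `π`, hence equal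
  -- to the old ones.
  obtain ⟨δ, hδ, hclose⟩ := hθ.exists_abs_sub_lt (primitive_continuousOn hq) Real.pi_pos
  refine ⟨δ, hδ, fun g y hg hgδ hy hyT => ?_⟩
  have hr : Integrable (fun x => q x + g x) unitMeasure := hq.add hg
  obtain ⟨η, hη0, hη⟩ := exists_isPruferAngle (primitive_continuousOn hr) μ 0
  have hprim : ∀ x ∈ Icc (0 : ℝ) 1,
      |primitive (fun x => q x + g x) x - primitive q x| ≤ δ := by
    intro x hx
    have hsub : uIcc 0 x ⊆ uIcc (0 : ℝ) 1 := by
      rw [uIcc_of_le hx.1, uIcc_of_le zero_le_one]; exact Icc_subset_Icc_right hx.2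
    have e : primitive (fun x => q x + g x) x - primitive q x = ∫ t in (0 : ℝ)..x, g t := by
      unfold primitive
      rw [intervalIntegral.integral_add ((intervalIntegrable_of_unitMeasure hq).mono_set hsub)
        ((intervalIntegrable_of_unitMeasure hg).mono_set hsub)]
      ring
    rw [e, ← Real.norm_eq_abs]
    refine (intervalIntegral.norm_integral_le_of_norm_le_const (C := δ) fun t ht => ?_).trans ?_
    · rw [uIoc_of_le hx.1] at ht
      exact hgδ t ⟨ht.1.le, ht.2.trans hx.2⟩
    · rw [sub_zero, abs_of_nonneg hx.1]
      exact mul_le_of_le_one_right hδ.le hx.2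
  have hclose' := hclose _ μ η hη (by rw [hη0, h0]) hprim (by simpa using hδ.le)
  refine hy.isNode hr hη hη0 hT (eq_nat_mul_pi_of_abs_sub_lt ?_ ?_)
    (eq_nat_mul_pi_of_abs_sub_lt ?_ ?_)
  · exact (hy.eq_zero_iff hr hη hη0 (Ioo_subset_Icc_self hT)).1 hyT
  · rw [← hi]; exact hclose' T (Ioo_subset_Icc_self hT)
  · exact (hy.eq_zero_iff hr hη hη0 (by simp)).1 hy.2.2.1
  · rw [← hm]; exact hclose' 1 (by simp)

/-- Perturbations orthogonal to `E²` on both sides of the node and supported away from the zeros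
of `E` are tangent to the set of potentials with the prescribed node. -/
lemma IsEigenfunction.exists_perturbation (hq : Integrable q unitMeasure) {θ : ℝ → ℝ}
    (hθ : IsPruferAngle (primitive q) μ θ) (h0 : θ 0 = 0) {E : ℝ → ℝ}
    (hE : IsEigenfunction q μ E) {T : ℝ} (hT : T ∈ Ioo (0 : ℝ) 1)
    {i m : ℕ} (hi : θ T = i * Real.pi) (hm : θ 1 = m * Real.pi) {h : ℝ → ℝ}
    (hh : ContinuousOn h (Icc 0 1)) (hhT : ∫ x in (0 : ℝ)..T, h x * E x ^ 2 = 0)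
    (hh1 : ∫ x in (0 : ℝ)..1, h x * E x ^ 2 = 0) {η : ℝ} (hη : 0 < η)
    (hsupp : ∀ x ∈ Icc (0 : ℝ) 1, h x ≠ 0 → η ≤ |E x|) :
    ∃ s₀ > 0, ∃ C, ∀ s, 0 < s → s < s₀ → ∃ g : ℝ → ℝ, AEStronglyMeasurable g unitMeasure ∧
      (∀ x ∈ Icc (0 : ℝ) 1, |g x| ≤ C ∧ |g x - h x| ≤ C * s) ∧
      IsNode (fun x => q x + s * g x) i m T := by
  have hET : E T = 0 := by
    rw [hE.eq_zero_iff hq hθ h0 (Ioo_subset_Icc_self hT), hi]; exact Real.sin_nat_mul_pi i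
  obtain ⟨w, ζ, hw, hζ, hζw, hw0, hwT, hw1⟩ :=
    hE.exists_linearization hq hET hh hhT hh1
  obtain ⟨⟨z, hz, hzac, hzE⟩, hE0, hE1, ⟨x₀, hx₀, hEx₀⟩⟩ := id hE
  have hwc : ContinuousOn w (Icc 0 1) := fun x hx => (hw x hx).continuousWithinAt
  have hEc : ContinuousOn E (Icc 0 1) := fun x hx => (hz x hx).continuousWithinAt
  obtain ⟨W, hW0, hW⟩ := exists_nonneg_bound hwc
  obtain ⟨H, hH0, hH⟩ := exists_nonneg_bound hh
  obtain ⟨δ, hδ, hnode⟩ := exists_isNode_of_abs_le hq hθ h0 hT hi hm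
  have hEx₀' := abs_pos.2 hEx₀
  -- The three bounds on `s` keep `|E + s w| ≥ η / 2` on the support of `h`, keep `E + s w` nonzero
  -- at `x₀`, and keep `|s g| ≤ δ`, so that the node index is preserved.
  refine ⟨min (min (η / (2 * (W + 1))) (|E x₀| / (W + 1))) (δ / (2 * H + 1)), by positivity,
    max (2 * H) (2 * H * W / η), fun s hs hs₀ => ?_⟩
  obtain ⟨⟨hs1, hs2⟩, hs3⟩ := lt_min_iff.1 hs₀ |>.imp_left lt_min_iff.1
  rw [lt_div_iff₀ (by positivity)] at hs1 hs2 hs3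
  have hsw : ∀ x ∈ Icc (0 : ℝ) 1, |s * w x| ≤ s * W := fun x hx => by
    rw [abs_mul, abs_of_pos hs]; exact mul_le_mul_of_nonneg_left (hW x hx) hs.le
  have hden : ∀ x ∈ Icc (0 : ℝ) 1, h x ≠ 0 → η / 2 ≤ |E x + s * w x| ∧
      |E x| ≤ 2 * |E x + s * w x| := fun x hx hhx => by
    have h1 := hsupp x hx hhx
    have h2 := hsw x hx
    have h3 : |E x| - |s * w x| ≤ |E x + s * w x| := by
      have := abs_sub_abs_le_abs_sub (E x) (-(s * w x))
      simpa using this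
    constructor <;> nlinarith
  -- Chosen so that `g (E + s w) = h E`, which makes `E + s w` an exact solution for `q + s g`.
  set g := fun x => h x * (E x / (E x + s * w x)) with hg
  have hgH : ∀ x ∈ Icc (0 : ℝ) 1, |g x| ≤ 2 * H := fun x hx => by
    by_cases hhx : h x = 0
    · simp only [hg, hhx, zero_mul, abs_zero]; positivity
    · obtain ⟨h1, h2⟩ := hden x hx hhx
      have h3 : |E x / (E x + s * w x)| ≤ 2 := by
        rw [abs_div, div_le_iff₀ (by linarith)]; exact h2
      calc |g x| = |h x| * |E x / (E x + s * w x)| := abs_mul _ _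
        _ ≤ H * 2 := mul_le_mul (hH x hx) h3 (abs_nonneg _) hH0
        _ = 2 * H := mul_comm _ _
  have hgh : ∀ x ∈ Icc (0 : ℝ) 1, |g x - h x| ≤ 2 * H * W / η * s := fun x hx => by
    by_cases hhx : h x = 0
    · simp only [hg, hhx, zero_mul, sub_zero, abs_zero]; positivity
    · obtain ⟨h1, h2⟩ := hden x hx hhx
      have hne : E x + s * w x ≠ 0 := by
        intro h; rw [h, abs_zero] at h1; linarith
      have e : g x - h x = -(h x * (s * w x) / (E x + s * w x)) := by
        simp only [hg]; field_simp; ring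
      rw [e, abs_neg, abs_div, abs_mul, div_le_iff₀ (by linarith)]
      calc |h x| * |s * w x| ≤ H * (s * W) := mul_le_mul (hH x hx) (hsw x hx) (abs_nonneg _) hH0
        _ = 2 * H * W / η * s * (η / 2) := by field_simp
        _ ≤ _ := by gcongr
  have hgm : AEStronglyMeasurable g unitMeasure := by
    have a1 := (hh.aestronglyMeasurable measurableSet_Icc (μ := volume)).aemeasurable
    have a2 := (hEc.aestronglyMeasurable measurableSet_Icc (μ := volume)).aemeasurable
    have a3 := (hwc.aestronglyMeasurable measurableSet_Icc (μ := volume)).aemeasurable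
    exact (a1.mul (a2.div (a2.add (a3.const_mul s)))).aestronglyMeasurable
  refine ⟨g, hgm, fun x hx => ⟨(hgH x hx).trans (le_max_left _ _), (hgh x hx).trans ?_⟩, ?_⟩
  · gcongr; exact le_max_right _ _
  have hsg : Integrable (fun x => s * g x) unitMeasure := by
    have : IsFiniteMeasure unitMeasure := by unfold unitMeasure; infer_instance
    refine Integrable.const_mul (Integrable.of_bound hgm (2 * H) ?_) s
    rw [ae_unitMeasure_iff]
    exact Filter.Eventually.of_forall hgH
  refine hnode (fun x => s * g x) (fun x => E x + s * w x) hsg (fun x hx => ?_) ⟨?_, ?_, ?_, ?_⟩ ?_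
  · rw [abs_mul, abs_of_pos hs]
    nlinarith [hgH x hx]
  · refine ⟨fun x => z x + s * ζ x, fun x hx => (hz x hx).add ((hw x hx).const_mul s),
      hzac.fun_add (hζ.const_mul s), ?_⟩
    rw [ae_unitMeasure_iff] at hzE hζw ⊢
    filter_upwards [hzE, hζw] with x h1 h2 hx
    convert! (h1 hx).add ((h2 hx).const_mul s) using 1
    have key : g x * (E x + s * w x) = h x * E x := by
      by_cases hhx : h x = 0
      · simp [hg, hhx]
      · obtain ⟨h1, h2⟩ := hden x hx hhx
        have hne : E x + s * w x ≠ 0 := by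
          intro h; rw [h, abs_zero] at h1; linarith
        simp only [hg]; field_simp
    linear_combination s * key
  · simp [hE0, hw0]
  · simp [hE1, hw1]
  · refine ⟨x₀, hx₀, fun hzero => ?_⟩
    have h1 := hsw x₀ hx₀
    have h2 : |E x₀| = |s * w x₀| := by
      rw [← abs_neg (s * w x₀)]; congr 1; linarith
    nlinarith
  · simp [hET, hwT]

lemma isSolution_add_const (c : ℝ) (y : ℝ → ℝ) (ν : ℝ) :
    IsSolution (fun x => q x + c) (ν + c) y ↔ IsSolution q ν y := by
  simp only [IsSolution, add_sub_add_right_eq_sub]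

lemma isEigenvalue_add_const (c ν : ℝ) :
    IsEigenvalue (fun x => q x + c) (ν + c) ↔ IsEigenvalue q ν := by
  simp only [IsEigenvalue, IsEigenfunction, isSolution_add_const]

/-- Adding a constant to the potential does not move the nodes. -/
lemma IsNode.add_const {i m : ℕ} {T : ℝ} (h : IsNode q i m T) (c : ℝ) :
    IsNode (fun x => q x + c) i m T := by
  obtain ⟨μ, E, ⟨⟨h1, h2⟩, h3⟩, h4⟩ := h
  refine ⟨μ + c, E, ⟨⟨(isEigenvalue_add_const c μ).2 h1, ?_⟩, ?_⟩, h4⟩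
  · have himage : {ν | IsEigenvalue (fun x => q x + c) ν ∧ ν < μ + c} =
        (fun ν => ν + c) '' {ν | IsEigenvalue q ν ∧ ν < μ} := by
      ext ν
      constructor
      · rintro ⟨a, b⟩
        exact ⟨ν - c, ⟨(isEigenvalue_add_const c _).1 (by simpa using a), by linarith⟩, by simp⟩
      · rintro ⟨ν', ⟨a, b⟩, rfl⟩
        exact ⟨(isEigenvalue_add_const c _).2 a, by simpa using b⟩
    rw [himage, (add_left_injective c).encard_image, h2]
  · simpa only [IsEigenfunction, isSolution_add_const] using h3

end Perturbation

/-! ### The function `φ_p` and the first variation of the `L^p` norm -/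

instance : IsFiniteMeasure unitMeasure := by unfold unitMeasure; infer_instance

lemma integral_unitMeasure (f : ℝ → ℝ) : ∫ x, f x ∂unitMeasure = ∫ x in (0 : ℝ)..1, f x := by
  rw [unitMeasure, integral_Icc_eq_integral_Ioc, intervalIntegral.integral_of_le zero_le_one]

section Phi

variable {p : ℝ}

/-- `φ_p` is `1/p` times the derivative of the `C¹` function `|·|^p`. This covers `p < 2`, where the
factor `|s|^(p-2)` is singular at `0`. -/
lemma continuous_phi (hp : 1 < p) : Continuous (phi p) := by
  have h := (contDiff_norm_rpow (E := ℝ) hp).continuous_deriv le_rfl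
  have e : phi p = fun x => p⁻¹ * deriv (fun x : ℝ => ‖x‖ ^ p) x := by
    ext x
    simp only [Real.norm_eq_abs]
    rw [(hasDerivAt_abs_rpow x hp).deriv, phi]
    have : p ≠ 0 := by positivity
    field_simp
  rw [e]
  exact h.const_mul _

lemma abs_phi (hp : 1 < p) (s : ℝ) : |phi p s| = |s| ^ (p - 1) := by
  rcases eq_or_ne s 0 with rfl | hs
  · simp [phi, Real.zero_rpow (sub_pos.2 hp).ne']
  · rw [phi, abs_mul, abs_of_nonneg (Real.rpow_nonneg (abs_nonneg s) _),
      show p - 1 = p - 2 + 1 by ring, Real.rpow_add_one (abs_ne_zero.2 hs)]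

lemma phi_mul_self (hp : 1 < p) (s : ℝ) : phi p s * s = |s| ^ p := by
  rcases eq_or_ne s 0 with rfl | hs
  · simp [Real.zero_rpow (zero_lt_one.trans hp).ne']
  · rw [phi, mul_assoc, ← abs_mul_abs_self s, ← mul_assoc,
      ← Real.rpow_add_one (abs_ne_zero.2 hs), ← Real.rpow_add_one (abs_ne_zero.2 hs)]
    congr 1; ring

/-- The tangent line inequality for the convex function `|·|^p`. -/
lemma abs_rpow_sub_le (hp : 1 < p) (a b : ℝ) : |b| ^ p - |a| ^ p ≤ p * phi p b * (b - a) := by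
  have hp0 : 0 < p := zero_lt_one.trans hp
  have hpq : p.HolderConjugate (p / (p - 1)) := Real.HolderConjugate.conjExponent hp
  have hy := Real.young_inequality_of_nonneg (abs_nonneg a)
    (Real.rpow_nonneg (abs_nonneg b) (p - 1)) hpq
  have hp1 : p - 1 ≠ 0 := (sub_pos.2 hp).ne'
  rw [← Real.rpow_mul (abs_nonneg b), mul_div_cancel₀ _ hp1] at hy
  have h1 : phi p b * a ≤ |a| * |b| ^ (p - 1) := by
    rw [← abs_phi hp, mul_comm (|a|), ← abs_mul]
    exact le_abs_self _
  have h2 := phi_mul_self hp b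
  have h3 : p * (|a| ^ p / p + |b| ^ p / (p / (p - 1))) = |a| ^ p + (p - 1) * |b| ^ p := by
    field_simp
  have h4 : p * (phi p b * a) ≤ |a| ^ p + (p - 1) * |b| ^ p := by
    rw [← h3]
    exact mul_le_mul_of_nonneg_left (h1.trans hy) hp0.le
  linear_combination h4 - p * h2

lemma lpNorm_eq (hp : 1 < p) {f : ℝ → ℝ} (hf : MemLp f (ENNReal.ofReal p) unitMeasure) :
    lpNorm p f = (∫ x, |f x| ^ p ∂unitMeasure) ^ p⁻¹ := by
  have hp0 : 0 < p := zero_lt_one.trans hp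
  rw [lpNorm, hf.eLpNorm_eq_integral_rpow_norm (by simpa using hp0) (by simp),
    ENNReal.toReal_ofReal (by positivity), ENNReal.toReal_ofReal hp0.le]
  rfl

lemma integrable_abs_rpow (hp : 1 < p) {f : ℝ → ℝ}
    (hf : MemLp f (ENNReal.ofReal p) unitMeasure) :
    Integrable (fun x => |f x| ^ p) unitMeasure := by
  have hp0 : 0 < p := zero_lt_one.trans hp
  have := hf.integrable_norm_rpow (by simpa using hp0) (by simp)
  rwa [ENNReal.toReal_ofReal hp0.le] at this

lemma integral_le_of_lpNorm_le (hp : 1 < p) {f g : ℝ → ℝ}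
    (hf : MemLp f (ENNReal.ofReal p) unitMeasure) (hg : MemLp g (ENNReal.ofReal p) unitMeasure)
    (h : lpNorm p f ≤ lpNorm p g) :
    ∫ x, |f x| ^ p ∂unitMeasure ≤ ∫ x, |g x| ^ p ∂unitMeasure := by
  rw [lpNorm_eq hp hf, lpNorm_eq hp hg] at h
  have hp0 : 0 < p := zero_lt_one.trans hp
  exact (Real.rpow_le_rpow_iff (by positivity) (by positivity) (by positivity)).1 h

/-- A crude bound, enough for domination because only bounded directions are tested; the dual
exponent is not needed. -/
lemma abs_phi_le (hp : 1 < p) {s t : ℝ} (h : |s| ≤ t) : |phi p s| ≤ 1 + t ^ p := by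
  have ht : 0 ≤ t := (abs_nonneg s).trans h
  have hp1 : 0 ≤ p - 1 := (sub_pos.2 hp).le
  rw [abs_phi hp]
  refine (Real.rpow_le_rpow (abs_nonneg s) h hp1).trans ?_
  rcases le_total t 1 with ht1 | ht1
  · have := Real.rpow_le_one ht ht1 hp1
    have := Real.rpow_nonneg ht p
    linarith
  · have := Real.rpow_le_rpow_of_exponent_le ht1 (by linarith : p - 1 ≤ p)
    linarith

lemma memLp_of_abs_le {g : ℝ → ℝ} (hgm : AEStronglyMeasurable g unitMeasure) {C : ℝ}
    (hgC : ∀ x ∈ Icc (0 : ℝ) 1, |g x| ≤ C) (r : ENNReal) : MemLp g r unitMeasure := by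
  refine MemLp.of_bound hgm C ?_
  rw [ae_unitMeasure_iff]
  exact Filter.Eventually.of_forall hgC

/-- First order necessary condition for the `L^p` norm along a tangent sequence. -/
lemma integral_phi_mul_nonneg (hp : 1 < p) {f h : ℝ → ℝ}
    (hf : MemLp f (ENNReal.ofReal p) unitMeasure) {s : ℕ → ℝ} (hs : ∀ n, 0 < s n)
    (hs1 : ∀ n, s n ≤ 1) (hs0 : Filter.Tendsto s Filter.atTop (nhds 0)) {g : ℕ → ℝ → ℝ}
    (hgm : ∀ n, AEStronglyMeasurable (g n) unitMeasure) {C : ℝ}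
    (hgC : ∀ n, ∀ x ∈ Icc (0 : ℝ) 1, |g n x| ≤ C)
    (hgh : ∀ x ∈ Icc (0 : ℝ) 1, Filter.Tendsto (fun n => g n x) Filter.atTop (nhds (h x)))
    (hmin : ∀ n, lpNorm p f ≤ lpNorm p (fun x => f x + s n * g n x)) :
    0 ≤ ∫ x, phi p (f x) * h x ∂unitMeasure := by
  have hp0 : 0 < p := zero_lt_one.trans hp
  have hC : 0 ≤ C := (abs_nonneg _).trans (hgC 0 0 (by simp))
  have hφ := continuous_phi hp
  have hfg : ∀ n, MemLp (fun x => f x + s n * g n x) (ENNReal.ofReal p) unitMeasure := fun n =>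
    hf.add ((memLp_of_abs_le (hgm n) (hgC n) _).const_mul (s n))
  have hbound : MemLp (fun x => |f x| + C) (ENNReal.ofReal p) unitMeasure :=
    hf.abs.add (memLp_const C)
  have hbi : Integrable (fun x => (1 + (|f x| + C) ^ p) * C) unitMeasure := by
    have := integrable_abs_rpow hp hbound
    refine ((integrable_const 1).add (this.congr ?_)).mul_const C
    refine Filter.Eventually.of_forall fun x => ?_
    simp only [abs_of_nonneg (add_nonneg (abs_nonneg (f x)) hC)]
  have hmeas : ∀ n, AEStronglyMeasurable (fun x => phi p (f x + s n * g n x) * g n x)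
      unitMeasure := fun n =>
    (hφ.comp_aestronglyMeasurable (hfg n).1).mul (hgm n)
  have hle : ∀ n, ∀ᵐ x ∂unitMeasure,
      ‖phi p (f x + s n * g n x) * g n x‖ ≤ (1 + (|f x| + C) ^ p) * C := fun n => by
    rw [ae_unitMeasure_iff]
    refine Filter.Eventually.of_forall fun x hx => ?_
    have h1 := hgC n x hx
    have h2 : |f x + s n * g n x| ≤ |f x| + C := by
      refine (abs_add_le _ _).trans (add_le_add le_rfl ?_)
      rw [abs_mul, abs_of_pos (hs n)]
      have := mul_le_mul (hs1 n) h1 (abs_nonneg _) zero_le_one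
      linarith
    have h3 := abs_phi_le hp h2
    rw [norm_mul]
    exact mul_le_mul h3 h1 (abs_nonneg _) ((abs_nonneg _).trans h3)
  -- Taking the tangent line at the perturbed point bounds the nonnegative increment of `∫ |·|^p` by
  -- `p s_n ∫ φ_p(f + s_n g_n) g_n`. This last integral is therefore nonnegative for every `n`, and
  -- dominated convergence passes to the limit.
  refine ge_of_tendsto' (tendsto_integral_of_dominated_convergence _ hmeas hbi hle ?_) fun n => ?_
  · rw [ae_unitMeasure_iff]
    refine Filter.Eventually.of_forall fun x hx => ?_
    have h1 := hgh x hx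
    have h2 : Filter.Tendsto (fun n => f x + s n * g n x) Filter.atTop (nhds (f x)) := by
      simpa using (hs0.mul h1).const_add (f x)
    exact ((hφ.tendsto _).comp h2).mul h1
  · have hint : Integrable (fun x => phi p (f x + s n * g n x) * g n x) unitMeasure :=
      hbi.mono' (hmeas n) (hle n)
    have h1 := integral_le_of_lpNorm_le hp hf (hfg n) (hmin n)
    have h2 : ∫ x, (|f x + s n * g n x| ^ p - |f x| ^ p) ∂unitMeasure ≤
        ∫ x, (p * s n) * (phi p (f x + s n * g n x) * g n x) ∂unitMeasure := by
      refine integral_mono ((integrable_abs_rpow hp (hfg n)).sub (integrable_abs_rpow hp hf))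
        (hint.const_mul _) fun x => ?_
      have := abs_rpow_sub_le hp (f x) (f x + s n * g n x)
      simp only [add_sub_cancel_left] at this
      linarith
    rw [integral_sub (integrable_abs_rpow hp (hfg n)) (integrable_abs_rpow hp hf),
      integral_const_mul] at h2
    have h3 : 0 < p * s n := mul_pos hp0 (hs n)
    by_contra! hneg
    have := mul_neg_of_pos_of_neg h3 hneg
    linarith

lemma integrable_phi (hp : 1 < p) {f : ℝ → ℝ}
    (hf : MemLp f (ENNReal.ofReal p) unitMeasure) :
    Integrable (fun x => phi p (f x)) unitMeasure := by
  refine ((integrable_const 1).add (integrable_abs_rpow hp hf)).mono'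
    ((continuous_phi hp).comp_aestronglyMeasurable hf.1) ?_
  exact Filter.Eventually.of_forall fun x => abs_phi_le hp le_rfl

/-- Passage from a family of admissible perturbations with direction `h + O(s)` to a sequence of
steps tending to `0`. -/
lemma IsOptimalPotential.integral_phi_mul_nonneg (hp : 1 < p) {i m : ℕ} {T κ : ℝ} {q : ℝ → ℝ}
    (hq : IsOptimalPotential p i m T (fun _ => κ) q) {h : ℝ → ℝ} {s₀ C : ℝ} (hs₀ : 0 < s₀)
    (hg : ∀ s, 0 < s → s < s₀ → ∃ g : ℝ → ℝ, AEStronglyMeasurable g unitMeasure ∧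
      (∀ x ∈ Icc (0 : ℝ) 1, |g x| ≤ C ∧ |g x - h x| ≤ C * s) ∧
      IsNode (fun x => q x + s * g x) i m T) :
    0 ≤ ∫ x, phi p (q x - κ) * h x ∂unitMeasure := by
  obtain ⟨hqp, -, hmin⟩ := hq
  set s : ℕ → ℝ := fun n => min (s₀ / 2) 1 / (n + 1) with hs
  have hpos : 0 < min (s₀ / 2) 1 := by positivity
  have hspos : ∀ n, 0 < s n := fun n => by positivity
  have hsle : ∀ n, s n ≤ min (s₀ / 2) 1 := fun n =>
    div_le_self hpos.le (by linarith [(Nat.cast_nonneg n : (0 : ℝ) ≤ n)])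
  have hs0 : Filter.Tendsto s Filter.atTop (nhds 0) := by
    have := (tendsto_one_div_add_atTop_nhds_zero_nat (𝕜 := ℝ)).const_mul (min (s₀ / 2) 1)
    simpa [hs, div_eq_mul_inv] using this
  have hslt : ∀ n, s n < s₀ := fun n => by
    have := (hsle n).trans (min_le_left _ _)
    linarith
  choose g hgm hgC hgn using fun n => hg (s n) (hspos n) (hslt n)
  refine InverseNodal.integral_phi_mul_nonneg hp (f := fun x => q x - κ)
    (hqp.sub (memLp_const κ)) hspos (fun n => (hsle n).trans (min_le_right _ _)) hs0 hgm (C := C)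
    (fun n x hx => (hgC n x hx).1) (fun x hx => ?_) (fun n => ?_)
  · rw [tendsto_iff_norm_sub_tendsto_zero]
    refine squeeze_zero (fun n => norm_nonneg _) (fun n => (hgC n x hx).2) ?_
    simpa using hs0.const_mul C
  · convert hmin _ (hqp.add ((memLp_of_abs_le (hgm n) (fun x hx => (hgC n x hx).1) _).const_mul
      (s n))) (hgn n) using 2
    ext x
    simp; ring

end Phi

/-! ### Zeros of eigenfunctions, test functions and the Euler–Lagrange equation -/

section Multiplier

variable {q : ℝ → ℝ} {μ : ℝ}

lemma IsEigenfunction.finite_zeros (hq : Integrable q unitMeasure) {E : ℝ → ℝ}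
    (hE : IsEigenfunction q μ E) : {x | x ∈ Ioo (0 : ℝ) 1 ∧ E x = 0}.Finite := by
  obtain ⟨θ, h0, hθ⟩ := exists_isPruferAngle (primitive_continuousOn hq) μ 0
  obtain ⟨k, hk0, hk⟩ := (isEigenvalue_iff hq hθ h0).1 ⟨E, hE⟩
  have hcard := hθ.encard_zeros h0 hk0 (by simp) hk
  have hset : {x | x ∈ Ioo (0 : ℝ) 1 ∧ E x = 0} =
      {t | t ∈ Ioo (0 : ℝ) 1 ∧ Real.sin (θ t) = 0} := by
    ext x
    simp only [mem_ofPred_eq, and_congr_right_iff]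
    exact fun hx => hE.eq_zero_iff hq hθ h0 (Ioo_subset_Icc_self hx)
  rw [hset, ← encard_ne_top_iff]
  intro h
  rw [h] at hcard
  simp at hcard

lemma IsEigenfunction.ae_ne_zero (hq : Integrable q unitMeasure) {E : ℝ → ℝ}
    (hE : IsEigenfunction q μ E) :
    ∀ᵐ x, x ∈ Icc (0 : ℝ) 1 → x ∈ Ioo (0 : ℝ) 1 ∧ E x ≠ 0 := by
  have h1 : ∀ᵐ x : ℝ, x ≠ 0 := by simp [ae_iff, measure_singleton]
  have h2 : ∀ᵐ x : ℝ, x ≠ 1 := by simp [ae_iff, measure_singleton]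
  have h3 : ∀ᵐ x : ℝ, x ∉ {x | x ∈ Ioo (0 : ℝ) 1 ∧ E x = 0} :=
    measure_eq_zero_iff_ae_notMem.1 ((hE.finite_zeros hq).measure_zero volume)
  filter_upwards [h1, h2, h3] with x h1 h2 h3 hx
  have hx' : x ∈ Ioo (0 : ℝ) 1 := ⟨lt_of_le_of_ne hx.1 h1.symm, lt_of_le_of_ne hx.2 h2⟩
  exact ⟨hx', fun h => h3 ⟨hx', h⟩⟩

lemma IsSolution.continuousOn {y : ℝ → ℝ} (h : IsSolution q μ y) :
    ContinuousOn y (Icc 0 1) := by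
  obtain ⟨z, hz, -⟩ := h
  exact fun x hx => (hz x hx).continuousWithinAt

/-- Compactness of the support gives the uniform lower bound on `|E|` that
`IsEigenfunction.exists_perturbation` requires of its directions. -/
lemma exists_le_abs_of_tsupport_subset {E g : ℝ → ℝ} (hE : ContinuousOn E (Icc 0 1))
    (hg : HasCompactSupport g) (hsub : tsupport g ⊆ {x | x ∈ Ioo (0 : ℝ) 1 ∧ E x ≠ 0}) :
    ∃ η > 0, ∀ x, g x ≠ 0 → η ≤ |E x| := by
  rcases (tsupport g).eq_empty_or_nonempty with h | h
  · refine ⟨1, one_pos, fun x hx => ?_⟩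
    have := subset_tsupport g hx
    simp [h] at this
  · obtain ⟨x₀, hx₀, hmin⟩ := hg.exists_isMinOn h (f := fun x => |E x|)
      ((hE.mono fun x hx => Ioo_subset_Icc_self (hsub hx).1).abs)
    exact ⟨|E x₀|, abs_pos.2 (hsub hx₀).2, fun x hx => hmin (subset_tsupport g hx)⟩

lemma isOpen_Ioo_inter_ne_zero {E : ℝ → ℝ} (hE : ContinuousOn E (Icc 0 1)) :
    IsOpen {x | x ∈ Ioo (0 : ℝ) 1 ∧ E x ≠ 0} :=
  (hE.mono Ioo_subset_Icc_self).isOpen_inter_preimage isOpen_Ioo isOpen_compl_singleton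

/-- A nonnegative bump inside `(α, β)` avoiding the zeros of an eigenfunction. -/
lemma IsEigenfunction.exists_bump (hq : Integrable q unitMeasure) {E : ℝ → ℝ}
    (hE : IsEigenfunction q μ E) {α β : ℝ} (hα : 0 ≤ α) (hαβ : α < β) (hβ : β ≤ 1) :
    ∃ χ : ℝ → ℝ, Continuous χ ∧ (∃ η > 0, ∀ x, χ x ≠ 0 → η ≤ |E x|) ∧
      (∀ x, x ∉ Ioo α β → χ x = 0) ∧ 0 < ∫ x in α..β, χ x * E x ^ 2 := by
  have hEc := hE.1.continuousOn
  obtain ⟨x₀, hx₀, hEx₀⟩ : ∃ x ∈ Ioo α β, E x ≠ 0 := by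
    by_contra! hcon
    refine Ioo_infinite hαβ ((hE.finite_zeros hq).subset fun x hx => ⟨?_, hcon x hx⟩)
    exact ⟨hα.trans_lt hx.1, hx.2.trans_le hβ⟩
  have hopen := (isOpen_Ioo_inter_ne_zero hEc).inter (isOpen_Ioo (a := α) (b := β))
  have hx₀' : x₀ ∈ Ioo (0 : ℝ) 1 := ⟨hα.trans_lt hx₀.1, hx₀.2.trans_le hβ⟩
  obtain ⟨χ, hχ1, hχ2, hχ3, hχ4, hχ5⟩ := exists_contDiff_tsupport_subset (n := 0)
    (hopen.mem_nhds ⟨⟨hx₀', hEx₀⟩, hx₀⟩)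
  have hχ0 : ∀ x, 0 ≤ χ x := fun x => (hχ4 ⟨x, rfl⟩).1
  have hχc : Continuous χ := hχ3.continuous
  refine ⟨χ, hχc, exists_le_abs_of_tsupport_subset hEc hχ2 (hχ1.trans inter_subset_left),
    fun x hx => ?_, ?_⟩
  · by_contra hne
    exact hx (hχ1 (subset_tsupport χ hne)).2
  · have hEc' : ContinuousOn E (Icc α β) := hEc.mono (Icc_subset_Icc hα hβ)
    refine intervalIntegral.integral_pos hαβ (by fun_prop)
      (fun x _ => mul_nonneg (hχ0 x) (sq_nonneg _)) ⟨x₀, Ioo_subset_Icc_self hx₀, ?_⟩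
    rw [hχ5, one_mul]
    positivity

/-- A continuous function vanishing outside `(α, β)` has vanishing weighted integrals elsewhere. -/
lemma integral_eq_zero_of_forall_notMem {χ f : ℝ → ℝ} {α β a b : ℝ} (hab : a ≤ b)
    (hχ : ∀ x, x ∉ Ioo α β → χ x = 0) (hdisj : ∀ x ∈ Ioc a b, x ∉ Ioo α β) :
    ∫ x in a..b, χ x * f x = 0 := by
  rw [intervalIntegral.integral_congr_ae (g := fun _ => 0), intervalIntegral.integral_zero]
  refine Filter.Eventually.of_forall fun x hx => ?_
  rw [uIoc_of_le hab] at hx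
  rw [hχ x (hdisj x hx), zero_mul]

/-- The Euler–Lagrange equation of the inverse nodal problem. -/
theorem IsOptimalPotential.exists_multipliers {p : ℝ} (hp : 1 < p) {i m : ℕ} {T κ : ℝ}
    (hT : T ∈ Ioo (0 : ℝ) 1) (hq : IsOptimalPotential p i m T (fun _ => κ) q) {E : ℝ → ℝ}
    (hE : IsNthEigenpair q m μ E) : ∃ k₀ k₁ : ℝ,
      (∀ᵐ x, x ∈ Icc (0 : ℝ) 1 →
        phi p (q x - κ) = (if x ≤ T then k₀ else k₁) * E x ^ 2) ∧
      k₀ * ∫ x in (0 : ℝ)..T, E x ^ 2 = -(k₁ * ∫ x in T..1, E x ^ 2) := by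
  have hqi : Integrable q unitMeasure := hq.1.integrable (by
    rw [ENNReal.one_le_ofReal]; exact hp.le)
  obtain ⟨θ, h0, hθ⟩ := exists_isPruferAngle (primitive_continuousOn hqi) μ 0
  obtain ⟨hθT, hθ1⟩ := hq.2.1.pruferAngle_eq hqi hθ h0 hE.1
  have hE' := hE.2
  have hEc := hE'.1.continuousOn
  set Φ := fun x => phi p (q x - κ) with hΦ
  have hΦi : Integrable Φ unitMeasure := integrable_phi hp (hq.1.sub (memLp_const κ))
  have hEc0 : ContinuousOn E (Icc 0 T) := hEc.mono (Icc_subset_Icc_right hT.2.le)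
  have hEc1 : ContinuousOn E (Icc T 1) := hEc.mono (Icc_subset_Icc_left hT.1.le)
  have hsplit : ∀ {f : ℝ → ℝ}, Continuous f → ∫ x in (0 : ℝ)..1, f x * E x ^ 2 =
      (∫ x in (0 : ℝ)..T, f x * E x ^ 2) + ∫ x in T..1, f x * E x ^ 2 := by
    intro f hf
    rw [intervalIntegral.integral_add_adjacent_intervals]
    · exact ContinuousOn.intervalIntegrable_of_Icc hT.1.le (by fun_prop)
    · exact ContinuousOn.intervalIntegrable_of_Icc hT.2.le (by fun_prop)
  have hΦmul : ∀ {f : ℝ → ℝ}, Continuous f → Integrable (fun x => Φ x * f x) unitMeasure := by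
    intro f hf
    obtain ⟨C, -, hC⟩ := exists_nonneg_bound hf.continuousOn
    refine hΦi.mul_bdd (c := C) hf.aestronglyMeasurable ?_
    rw [ae_unitMeasure_iff]
    exact Filter.Eventually.of_forall hC
  have hnonneg : ∀ h : ℝ → ℝ, Continuous h → (∫ x in (0 : ℝ)..T, h x * E x ^ 2) = 0 →
      (∫ x in T..1, h x * E x ^ 2) = 0 → (∃ η > 0, ∀ x, h x ≠ 0 → η ≤ |E x|) →
      0 ≤ ∫ x, Φ x * h x ∂unitMeasure := by
    rintro h hc hhT hh1 ⟨η, hη, hsupp⟩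
    obtain ⟨s₀, hs₀, C, hC⟩ := hE'.exists_perturbation hqi hθ h0 hT hθT hθ1 hc.continuousOn hhT
      (by rw [hsplit hc, hhT, hh1, add_zero]) hη fun x _ => hsupp x
    exact hq.integral_phi_mul_nonneg hp hs₀ hC
  have hzero : ∀ h : ℝ → ℝ, Continuous h → (∫ x in (0 : ℝ)..T, h x * E x ^ 2) = 0 →
      (∫ x in T..1, h x * E x ^ 2) = 0 → (∃ η > 0, ∀ x, h x ≠ 0 → η ≤ |E x|) →
      ∫ x, Φ x * h x ∂unitMeasure = 0 := by
    rintro h hc hhT hh1 ⟨η, hη, hsupp⟩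
    refine le_antisymm ?_ (hnonneg h hc hhT hh1 ⟨η, hη, hsupp⟩)
    have := hnonneg (fun x => -h x) hc.neg (by simpa using hhT) (by simpa using hh1)
      ⟨η, hη, fun x hx => hsupp x (by simpa using hx)⟩
    simp only [mul_neg, integral_neg] at this
    linarith
  -- Adding a constant leaves the nodes fixed, so the constants `1` and `-1` are admissible
  -- directions too.
  have hΦ0 : ∫ x, Φ x ∂unitMeasure = 0 := by
    have hc : ∀ c : ℝ, |c| ≤ 1 → 0 ≤ ∫ x, Φ x * c ∂unitMeasure := fun c hc =>
      hq.integral_phi_mul_nonneg hp (h := fun _ => c) (s₀ := 1) (C := 1) one_pos fun s hs _ =>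
        ⟨fun _ => c, aestronglyMeasurable_const, fun x _ => ⟨hc, by simpa using hs.le⟩,
          hq.2.1.add_const _⟩
    have h1 := hc 1 (by simp)
    have h2 := hc (-1) (by simp)
    simp only [mul_one, mul_neg, integral_neg] at h1 h2
    linarith
  obtain ⟨χ₀, hχ₀c, ⟨η₀, hη₀, hχ₀E⟩, hχ₀, hP₀⟩ := hE'.exists_bump hqi le_rfl hT.1 hT.2.le
  obtain ⟨χ₁, hχ₁c, ⟨η₁, hη₁, hχ₁E⟩, hχ₁, hP₁⟩ := hE'.exists_bump hqi hT.1.le hT.2 le_rfl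
  set P₀ := ∫ x in (0 : ℝ)..T, χ₀ x * E x ^ 2 with hP₀def
  set P₁ := ∫ x in T..1, χ₁ x * E x ^ 2 with hP₁def
  have hχ₀1 : ∫ x in T..1, χ₀ x * E x ^ 2 = 0 :=
    integral_eq_zero_of_forall_notMem hT.2.le hχ₀ fun x hx hx' => not_lt.2 hx.1.le hx'.2
  have hχ₁0 : ∫ x in (0 : ℝ)..T, χ₁ x * E x ^ 2 = 0 :=
    integral_eq_zero_of_forall_notMem hT.1.le hχ₁ fun x hx hx' => not_lt.2 hx.2 hx'.1
  set k₀ := (∫ x, Φ x * χ₀ x ∂unitMeasure) / P₀ with hk₀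
  set k₁ := (∫ x, Φ x * χ₁ x ∂unitMeasure) / P₁ with hk₁
  have hint0 : ∀ {f : ℝ → ℝ}, Continuous f →
      IntervalIntegrable (fun x => f x * E x ^ 2) volume 0 T := fun hf =>
    ContinuousOn.intervalIntegrable_of_Icc hT.1.le (by fun_prop)
  have hint1 : ∀ {f : ℝ → ℝ}, Continuous f →
      IntervalIntegrable (fun x => f x * E x ^ 2) volume T 1 := fun hf =>
    ContinuousOn.intervalIntegrable_of_Icc hT.2.le (by fun_prop)
  -- Subtracting suitable multiples of the bumps `χ₀` and `χ₁` makes any such `g` orthogonal to `E²`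
  -- on both sides; `k₀` and `k₁` record the cost of this correction.
  have htest : ∀ g : ℝ → ℝ, Continuous g → (∃ η > 0, ∀ x, g x ≠ 0 → η ≤ |E x|) →
      ∫ x, Φ x * g x ∂unitMeasure =
        k₀ * (∫ x in (0 : ℝ)..T, g x * E x ^ 2) + k₁ * ∫ x in T..1, g x * E x ^ 2 := by
    rintro g hgc ⟨η, hη, hg⟩
    set A₀ := ∫ x in (0 : ℝ)..T, g x * E x ^ 2 with hA₀
    set A₁ := ∫ x in T..1, g x * E x ^ 2 with hA₁
    have e : ∀ a b : ℝ, (∫ x in a..b, (g x - A₀ / P₀ * χ₀ x - A₁ / P₁ * χ₁ x) * E x ^ 2) =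
        ∫ x in a..b, (g x * E x ^ 2 - A₀ / P₀ * (χ₀ x * E x ^ 2) -
          A₁ / P₁ * (χ₁ x * E x ^ 2)) := fun a b => by
      congr 1; ext x; ring
    have key := hzero (fun x => g x - A₀ / P₀ * χ₀ x - A₁ / P₁ * χ₁ x) (by fun_prop) (by
      rw [e, intervalIntegral.integral_sub ((hint0 hgc).sub ((hint0 hχ₀c).const_mul _))
        ((hint0 hχ₁c).const_mul _), intervalIntegral.integral_sub (hint0 hgc)
        ((hint0 hχ₀c).const_mul _), intervalIntegral.integral_const_mul,
        intervalIntegral.integral_const_mul, hχ₁0, ← hA₀, ← hP₀def, div_mul_cancel₀ _ hP₀.ne']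
      ring) (by
      rw [e, intervalIntegral.integral_sub ((hint1 hgc).sub ((hint1 hχ₀c).const_mul _))
        ((hint1 hχ₁c).const_mul _), intervalIntegral.integral_sub (hint1 hgc)
        ((hint1 hχ₀c).const_mul _), intervalIntegral.integral_const_mul,
        intervalIntegral.integral_const_mul, hχ₀1, ← hA₁, ← hP₁def, div_mul_cancel₀ _ hP₁.ne']
      ring) ⟨min η (min η₀ η₁), by positivity, fun x hx => by
        by_cases h1 : g x = 0
        · by_cases h2 : χ₀ x = 0
          · have h3 : χ₁ x ≠ 0 := fun h3 => hx (by rw [h1, h2, h3]; ring)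
            exact (min_le_right _ _).trans ((min_le_right _ _).trans (hχ₁E x h3))
          · exact (min_le_right _ _).trans ((min_le_left _ _).trans (hχ₀E x h2))
        · exact (min_le_left _ _).trans (hg x h1)⟩
    have e2 : (fun x => Φ x * (g x - A₀ / P₀ * χ₀ x - A₁ / P₁ * χ₁ x)) = fun x =>
        Φ x * g x - A₀ / P₀ * (Φ x * χ₀ x) - A₁ / P₁ * (Φ x * χ₁ x) := by
      ext x; ring
    have hi : Integrable (fun x => Φ x * g x - A₀ / P₀ * (Φ x * χ₀ x)) unitMeasure :=
      (hΦmul hgc).sub ((hΦmul hχ₀c).const_mul _)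
    rw [e2, integral_sub hi ((hΦmul hχ₁c).const_mul _), integral_sub (hΦmul hgc) ((hΦmul hχ₀c).const_mul _),
      integral_const_mul, integral_const_mul] at key
    rw [hk₀, hk₁]
    linear_combination key
  set K := fun x => (if x ≤ T then k₀ else k₁) * E x ^ 2 with hK
  have hK0 : ∀ f : ℝ → ℝ, ∫ x in (0 : ℝ)..T, f x * K x =
      k₀ * ∫ x in (0 : ℝ)..T, f x * E x ^ 2 := fun f => by
    rw [← intervalIntegral.integral_const_mul]
    refine intervalIntegral.integral_congr_ae (Filter.Eventually.of_forall fun x hx => ?_)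
    rw [uIoc_of_le hT.1.le] at hx
    simp only [hK, if_pos hx.2]; ring
  have hK1 : ∀ f : ℝ → ℝ, ∫ x in T..1, f x * K x =
      k₁ * ∫ x in T..1, f x * E x ^ 2 := fun f => by
    rw [← intervalIntegral.integral_const_mul]
    refine intervalIntegral.integral_congr_ae (Filter.Eventually.of_forall fun x hx => ?_)
    rw [uIoc_of_le hT.2.le] at hx
    simp only [hK, if_neg (not_le.2 hx.1)]; ring
  have hKi0 : ∀ {f : ℝ → ℝ}, Continuous f →
      IntervalIntegrable (fun x => f x * K x) volume 0 T := fun {f} hf => by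
    refine ((hint0 hf).const_mul k₀).congr fun x hx => ?_
    rw [uIoc_of_le hT.1.le] at hx
    simp only [hK, if_pos hx.2]; ring
  have hKi1 : ∀ {f : ℝ → ℝ}, Continuous f →
      IntervalIntegrable (fun x => f x * K x) volume T 1 := fun {f} hf => by
    refine ((hint1 hf).const_mul k₁).congr fun x hx => ?_
    rw [uIoc_of_le hT.2.le] at hx
    simp only [hK, if_neg (not_le.2 hx.1)]; ring
  have hKint : ∀ {f : ℝ → ℝ}, Continuous f → Integrable (fun x => f x * K x) unitMeasure :=
    fun hf => (intervalIntegrable_iff_integrableOn_Icc_of_le zero_le_one).1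
      ((hKi0 hf).trans (hKi1 hf))
  have hKval : ∀ {f : ℝ → ℝ}, Continuous f → ∫ x, f x * K x ∂unitMeasure =
      k₀ * (∫ x in (0 : ℝ)..T, f x * E x ^ 2) + k₁ * ∫ x in T..1, f x * E x ^ 2 := fun {f} hf => by
    rw [integral_unitMeasure, ← intervalIntegral.integral_add_adjacent_intervals (hKi0 hf)
      (hKi1 hf), hK0, hK1]
  have hKi : Integrable K unitMeasure := by simpa using hKint (f := fun _ => 1) continuous_const
  -- Fundamental lemma of the calculus of variations on the open set where `E ≠ 0`, which has full
  -- measure in `[0, 1]`.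
  have hfund := (isOpen_Ioo_inter_ne_zero hEc).ae_eq_zero_of_integral_contDiff_smul_eq_zero
    (μ := unitMeasure) (f := fun x => Φ x - K x)
    ((hΦi.sub hKi).locallyIntegrable.locallyIntegrableOn _) (fun g hg hgc hgs => by
      have e : (fun x => g x • (Φ x - K x)) = fun x => Φ x * g x - g x * K x := by
        ext x; simp only [smul_eq_mul]; ring
      rw [e, integral_sub (hΦmul hg.continuous) (hKint hg.continuous), hKval hg.continuous,
        htest g hg.continuous (exists_le_abs_of_tsupport_subset hEc hgc hgs), sub_self])
  have hae : ∀ᵐ x, x ∈ Icc (0 : ℝ) 1 → Φ x = K x := by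
    rw [ae_unitMeasure_iff] at hfund
    filter_upwards [hfund, hE'.ae_ne_zero hqi] with x h1 h2 hx
    exact sub_eq_zero.1 (h1 hx (h2 hx))
  refine ⟨k₀, k₁, hae, ?_⟩
  have h1 : ∫ x, Φ x ∂unitMeasure = ∫ x, 1 * K x ∂unitMeasure := by
    refine integral_congr_ae ?_
    rw [Filter.EventuallyEq, ae_unitMeasure_iff]
    filter_upwards [hae] with x hx hxI
    rw [hx hxI, one_mul]
  rw [hΦ0, hKval continuous_const] at h1
  simp only [one_mul] at h1
  linarith

end Multiplier

/-! ### Inversion of the multiplier equation and nondegeneracy -/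

section Conclusion

variable {p : ℝ} {q : ℝ → ℝ} {μ κ : ℝ}

lemma sign_mul_self_of_ne_zero {k : ℝ} (hk : k ≠ 0) : Real.sign k * Real.sign k = 1 := by
  rcases Real.sign_apply_eq_of_ne_zero k hk with h | h <;> simp [h]

/-- Inversion of `φ_p`. -/
lemma eq_sign_mul_of_phi_eq (hp : 1 < p) {f k e : ℝ} (hk : k ≠ 0) (h : phi p f = k * e ^ 2) :
    f = Real.sign k * |√|k| * e| ^ (2 * (p / (p - 1)) - 2) := by
  have hp1 : 0 < p - 1 := sub_pos.2 hp
  have hs := sign_mul_self_of_ne_zero hk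
  have habs : |k| = Real.sign k * k := by
    rcases lt_or_gt_of_ne hk with h | h
    · rw [Real.sign_of_neg h, abs_of_neg h]; ring
    · rw [Real.sign_of_pos h, abs_of_pos h]; ring
  have h1 : |f| ^ (p - 1) = |√|k| * e| ^ (2 : ℝ) := by
    rw [← abs_phi hp, h, abs_mul, abs_of_nonneg (sq_nonneg e), Real.rpow_two, sq_abs, mul_pow,
      Real.sq_sqrt (abs_nonneg k)]
  -- The exponents agree because `2 / (p - 1) = 2p* - 2`.
  have h2 : |f| = |√|k| * e| ^ (2 * (p / (p - 1)) - 2) := by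
    have h3 : |f| = (|f| ^ (p - 1)) ^ (p - 1)⁻¹ := by
      rw [← Real.rpow_mul (abs_nonneg f), mul_inv_cancel₀ hp1.ne', Real.rpow_one]
    rw [h3, h1, ← Real.rpow_mul (abs_nonneg _)]
    congr 1
    field_simp
    ring
  rw [← h2]
  rcases eq_or_ne f 0 with rfl | hf
  · simp
  · have hpos : 0 < |f| ^ (p - 2) := Real.rpow_pos_of_pos (abs_pos.2 hf) _
    have h4 : 0 ≤ Real.sign k * f := by
      have h5 : |f| ^ (p - 2) * (Real.sign k * f) = |k| * e ^ 2 := by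
        rw [habs, mul_assoc, ← h, phi]; ring
      have h6 : 0 ≤ |k| * e ^ 2 := by positivity
      rw [← h5] at h6
      exact nonneg_of_mul_nonneg_right h6 hpos
    have h7 : |f| = Real.sign k * f := by
      rw [← abs_of_nonneg h4, abs_mul]
      rcases Real.sign_apply_eq_of_ne_zero k hk with h | h <;> simp [h]
    rw [h7, ← mul_assoc, hs, one_mul]

/-- A rescaled eigenfunction solves the critical equation on an interval where the potential is
given by the critical formula. -/
lemma IsSolution.solvesOn (hp : 1 < p) {E : ℝ → ℝ} (hE : IsSolution q μ E) {a b r σ : ℝ}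
    (ha : 0 ≤ a) (hab : a < b) (hb : b ≤ 1)
    (hq : ∀ᵐ x, x ∈ Icc a b → q x - κ = σ * |r * E x| ^ (2 * (p / (p - 1)) - 2)) {u : ℝ → ℝ}
    (hu : ∀ x ∈ Icc a b, u x = r * E x) : SolvesOn p a b (fun _ => κ) μ σ u := by
  obtain ⟨z, hz, hzac, hzE⟩ := id hE
  have hsub : Icc a b ⊆ Icc (0 : ℝ) 1 := Icc_subset_Icc ha hb
  have hEc : ContinuousOn E (Icc a b) := hE.continuousOn.mono hsub
  have hp1 : 0 < p - 1 := sub_pos.2 hp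
  have hφ : Continuous (phi (2 * (p / (p - 1)))) := by
    refine continuous_phi ?_
    have : 1 < p / (p - 1) := (one_lt_div hp1).2 (by linarith)
    linarith
  refine ⟨fun x => r * z x, fun x => (κ - μ) * (r * E x) + σ * phi (2 * (p / (p - 1))) (r * E x),
    fun x hx => ⟨?_, ?_, ?_⟩⟩
  · exact (((hz x (hsub hx)).mono hsub).const_mul r).congr hu (hu x hx)
  · have hzr : AbsolutelyContinuousOnInterval (fun x => r * z x) a b :=
      (hzac.mono (by rwa [uIcc_of_le hab.le, uIcc_of_le zero_le_one])).const_mul r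
    -- Inserting the formula for `q` turns the almost everywhere derivative `r (q - μ) E` into a
    -- continuous expression, so the equation holds at every point.
    refine hasDerivWithinAt_of_absolutelyContinuousOnInterval
      (g := fun x => (κ - μ) * (r * E x) + σ * phi (2 * (p / (p - 1))) (r * E x)) hab.le hzr
      ((by fun_prop : ContinuousOn (fun x => (κ - μ) * (r * E x)) (Icc a b)).add
        ((hφ.comp_continuousOn (by fun_prop)).const_smul σ)) ?_ hx
    rw [ae_unitMeasure_iff] at hzE
    filter_upwards [hq, hzE] with t h1 h2 ht
    convert! (h2 (hsub ht)).const_mul r using 1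
    rw [phi]
    linear_combination (-(r * E t)) * h1 ht
  · simp only [hu x hx]
    ring

/-- A constant potential satisfies both comparison hypotheses, which together force `T = i / m`. -/
lemma IsOptimalPotential.not_ae_eq (hp : 1 < p) {i m : ℕ} (hi : 1 ≤ i) (him : i < m) {T : ℝ}
    (hTne : T ≠ (i : ℝ) / m) (hq : IsOptimalPotential p i m T (fun _ => κ) q) :
    ¬ ∀ᵐ x, x ∈ Icc (0 : ℝ) 1 → q x - κ = 0 := by
  intro h
  have hqi : Integrable q unitMeasure := hq.1.integrable (by
    rw [ENNReal.one_le_ofReal]; exact hp.le)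
  obtain ⟨-, -, -, hT, -⟩ := hq.2.1
  have hl : ∀ᵐ x, x ∈ Ioo 0 T → q x = κ := by
    filter_upwards [h] with x hx hxT
    exact sub_eq_zero.1 (hx ⟨hxT.1.le, hxT.2.le.trans hT.2.le⟩)
  have hr : ∀ᵐ x, x ∈ Ioo T 1 → q x = κ := by
    filter_upwards [h] with x hx hxT
    exact sub_eq_zero.1 (hx ⟨hT.1.le.trans hxT.1.le, hxT.2.le⟩)
  exact hTne (le_antisymm
    (hq.2.1.le_div_of_le_of_le hqi hi him (hl.mono fun x hx hxT => (hx hxT).le)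
      (hr.mono fun x hx hxT => (hx hxT).ge))
    (hq.2.1.div_le_of_le_of_le hqi hi him (hl.mono fun x hx hxT => (hx hxT).ge)
      (hr.mono fun x hx hxT => (hx hxT).le)))

lemma IsEigenfunction.integral_sq_pos (hq : Integrable q unitMeasure) {E : ℝ → ℝ}
    (hE : IsEigenfunction q μ E) {α β : ℝ} (hα : 0 ≤ α) (hαβ : α < β) (hβ : β ≤ 1) :
    0 < ∫ x in α..β, E x ^ 2 := by
  have hEc : ContinuousOn E (Icc α β) := hE.1.continuousOn.mono (Icc_subset_Icc hα hβ)
  obtain ⟨x₀, hx₀, hEx₀⟩ : ∃ x ∈ Ioo α β, E x ≠ 0 := by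
    by_contra! hcon
    refine Ioo_infinite hαβ ((hE.finite_zeros hq).subset fun x hx => ⟨?_, hcon x hx⟩)
    exact ⟨hα.trans_lt hx.1, hx.2.trans_le hβ⟩
  exact intervalIntegral.integral_pos hαβ (by fun_prop) (fun x _ => sq_nonneg _)
    ⟨x₀, Ioo_subset_Icc_self hx₀, by positivity⟩

/-- At a zero of `E` the derivative equals the quasi-derivative, and the polar form forbids both `E`
and `u` to vanish. -/
lemma IsEigenfunction.deriv_ne_zero (hq : Integrable q unitMeasure) {E : ℝ → ℝ}
    (hE : IsEigenfunction q μ E) {T : ℝ} (hT : T ∈ Ioo (0 : ℝ) 1) (hET : E T = 0) :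
    deriv E T ≠ 0 := by
  obtain ⟨θ, h0, hθ⟩ := exists_isPruferAngle (primitive_continuousOn hq) μ 0
  obtain ⟨u, hu⟩ := hE.1.exists_isRegularized hq
  obtain ⟨r, hr, h⟩ := hE.exists_polar hq hθ h0 hu
  have hTI := Ioo_subset_Icc_self hT
  have hd := (hu T hTI).1.hasDerivAt (Icc_mem_nhds hT.1 hT.2)
  rw [hd.deriv, hET, mul_zero, add_zero, (h T hTI).2]
  have hsin := (hE.eq_zero_iff hq hθ h0 hTI).1 hET
  refine mul_ne_zero (hr T) fun hcos => ?_
  have := Real.sin_sq_add_cos_sq (θ T)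
  simp [hsin, hcos] at this

lemma coeffA_eq (T : ℝ) (E : ℝ → ℝ) :
    coeffA T E = (∫ x in T..1, E x ^ 2) / deriv E T ^ 2 := by
  simp only [coeffA, div_pow, intervalIntegral.integral_div]

lemma coeffB_eq (T : ℝ) (E : ℝ → ℝ) :
    coeffB T E = (∫ x in (0 : ℝ)..T, E x ^ 2) / deriv E T ^ 2 := by
  simp only [coeffB, div_pow, intervalIntegral.integral_div]

lemma lpNorm_pos (hp : 1 < p) {f : ℝ → ℝ} (hf : MemLp f (ENNReal.ofReal p) unitMeasure)
    (hne : ¬ ∀ᵐ x, x ∈ Icc (0 : ℝ) 1 → f x = 0) : 0 < lpNorm p f := by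
  refine lt_of_le_of_ne ENNReal.toReal_nonneg fun h => hne ?_
  rw [lpNorm, eq_comm, ENNReal.toReal_eq_zero_iff, or_iff_left hf.2.ne,
    eLpNorm_eq_zero_iff hf.1 (by simpa using zero_lt_one.trans hp)] at h
  rw [← ae_unitMeasure_iff]
  exact h

end Conclusion

end InverseNodal

end

/-! ### The main theorem: normalization of the multiplier and sign of `ε` -/

open InverseNodal in
theorem mainTheorem3 (p : ℝ) (hp : 1 < p) (i m : ℕ) (hi : 1 ≤ i) (him : i < m)
    (T : ℝ) (hT : T ∈ Set.Ioo (0 : ℝ) 1) (hTne : T ≠ (i : ℝ) / m) (κ : ℝ)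
    (q : ℝ → ℝ) (hq : InverseNodal.IsOptimalPotential p i m T (fun _ => κ) q)
    (μ : ℝ) (E : ℝ → ℝ) (hE : InverseNodal.IsNthEigenpair q m μ E) :
    ∃ c : ℝ, c ≠ 0 ∧
      (∀ c' : ℝ, InverseNodal.IsMultiplier p T (fun _ => κ) q E c' ↔ c' = c) ∧
      ∃ ε : ℝ, ε = Real.sign c ∧
        InverseNodal.CriticalPotential p T (fun _ => κ) q ε
          (InverseNodal.scaledEigenfunction p T (fun _ => κ) q E c) ∧
        InverseNodal.CriticalEquation p T (fun _ => κ) μ ε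
          (InverseNodal.scaledEigenfunction p T (fun _ => κ) q E c) ∧
        (0 < T ∧ T < (i : ℝ) / m → ε = -1) ∧
        ((i : ℝ) / m < T ∧ T < 1 → ε = 1) := by
  have hqi : Integrable q unitMeasure := hq.1.integrable (by
    rw [ENNReal.one_le_ofReal]; exact hp.le)
  have hE' := hE.2
  have hET : E T = 0 := by
    obtain ⟨θ, h0, hθ⟩ := exists_isPruferAngle (primitive_continuousOn hqi) μ 0
    obtain ⟨hθT, -⟩ := hq.2.1.pruferAngle_eq hqi hθ h0 hE.1
    rw [hE'.eq_zero_iff hqi hθ h0 (Ioo_subset_Icc_self hT), hθT]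
    exact Real.sin_nat_mul_pi i
  have hne := hq.not_ae_eq hp hi him hTne
  obtain ⟨k₀, k₁, hk, hk01⟩ := hq.exists_multipliers hp hT hE
  have hB := hE'.integral_sq_pos hqi le_rfl hT.1 hT.2.le
  have hA := hE'.integral_sq_pos hqi hT.1.le hT.2 le_rfl
  set A := ∫ x in T..1, E x ^ 2
  set B := ∫ x in (0 : ℝ)..T, E x ^ 2
  set D := deriv E T with hD
  have hDne : D ≠ 0 := hE'.deriv_ne_zero hqi hT hET
  have hD2 : 0 < D ^ 2 := by positivity
  set N := lpNorm p (fun t => q t - κ) with hN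
  have hNpos : 0 < N := lpNorm_pos hp (hq.1.sub (memLp_const κ)) hne
  have hNN : N ^ (p - 1) * N ^ (1 - p) = 1 := by
    rw [← Real.rpow_add hNpos]; simp
  have hN1 : 0 < N ^ (1 - p) := Real.rpow_pos_of_pos hNpos _
  have hk₁ : k₁ = -(k₀ * (B / A)) := by field_simp; linarith
  have hk₀ : k₀ ≠ 0 := by
    intro h
    refine hne ?_
    filter_upwards [hk] with x hx hxI
    have h1 := hx hxI
    rw [hk₁, h] at h1
    have h2 := phi_mul_self hp (q x - κ)
    rw [h1] at h2
    have h3 : |q x - κ| ^ p = 0 := by rw [← h2]; simp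
    exact abs_eq_zero.1 ((Real.rpow_eq_zero (abs_nonneg _) (by linarith)).1 h3)
  have hk₁ne : k₁ ≠ 0 := by
    rw [hk₁]; exact neg_ne_zero.2 (mul_ne_zero hk₀ (div_pos hB hA).ne')
  have hsign₁ : Real.sign k₁ = -Real.sign k₀ := by
    have hBA := div_pos hB hA
    rcases lt_or_gt_of_ne hk₀ with h | h
    · rw [Real.sign_of_neg h, Real.sign_of_pos (by rw [hk₁]; nlinarith)]; simp
    · rw [Real.sign_of_pos h, Real.sign_of_neg (by rw [hk₁]; nlinarith)]
  -- Forced by the equation on `[0, T]`, where `H = a = A / D²`. The relation between `k₀` and `k₁`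
  -- makes the same `c` work on `(T, 1]`, and then `â = k₀` and `b̂ = -k₁`.
  set c := N ^ (1 - p) * k₀ / (A / D ^ 2) with hc
  have hcA : c * (A / D ^ 2) = N ^ (1 - p) * k₀ := by rw [hc]; field_simp
  have hcB : c * (B / D ^ 2) = -(N ^ (1 - p) * k₁) := by rw [hc, hk₁]; field_simp
  have hstep : ∀ x, c * stepH T E x = N ^ (1 - p) * (if x ≤ T then k₀ else k₁) := by
    intro x
    rw [stepH, coeffA_eq, coeffB_eq]
    split_ifs
    · exact hcA
    · rw [mul_neg, hcB, neg_neg]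
  have hsc : Real.sign c = Real.sign k₀ := by
    have h1 : 0 < A / D ^ 2 := by positivity
    rcases lt_or_gt_of_ne hk₀ with h | h
    · rw [Real.sign_of_neg h, Real.sign_of_neg]
      exact div_neg_of_neg_of_pos (mul_neg_of_pos_of_neg hN1 h) h1
    · rw [Real.sign_of_pos h, Real.sign_of_pos]
      exact div_pos (mul_pos hN1 h) h1
  have hu : ∀ x, scaledEigenfunction p T (fun _ => κ) q E c x =
      if x ≤ T then √|k₀| * E x else √|k₁| * E x := by
    intro x
    simp only [scaledEigenfunction, coeffA_eq, coeffB_eq]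
    have e1 : N ^ (p - 1) * (A / D ^ 2) * c = k₀ := by
      linear_combination N ^ (p - 1) * hcA + k₀ * hNN
    have e2 : N ^ (p - 1) * (B / D ^ 2) * c = -k₁ := by
      linear_combination N ^ (p - 1) * hcB - k₁ * hNN
    rw [e1, e2, abs_neg]
  have hmult : IsMultiplier p T (fun _ => κ) q E c := by
    rw [IsMultiplier, ae_unitMeasure_iff]
    filter_upwards [hk] with x hx hxI
    rw [hstep, hx hxI]; ring
  have hpot : ∀ᵐ x, x ∈ Icc (0 : ℝ) 1 → q x - κ =
      (if x ≤ T then Real.sign c else -Real.sign c) *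
        |if x ≤ T then √|k₀| * E x else √|k₁| * E x| ^ (2 * (p / (p - 1)) - 2) := by
    filter_upwards [hk] with x hx hxI
    have h1 := hx hxI
    rw [hsc, ← hsign₁]
    split_ifs at h1 ⊢
    · exact eq_sign_mul_of_phi_eq hp hk₀ h1
    · exact eq_sign_mul_of_phi_eq hp hk₁ne h1
  have hTne' : ∀ᵐ x : ℝ, x ≠ T := by simp [ae_iff, measure_singleton]
  have hpot0 : ∀ᵐ x, x ∈ Icc 0 T →
      q x - κ = Real.sign c * |√|k₀| * E x| ^ (2 * (p / (p - 1)) - 2) := by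
    filter_upwards [hpot] with x hx hxI
    simpa only [if_pos hxI.2] using hx ⟨hxI.1, hxI.2.trans hT.2.le⟩
  have hpot1 : ∀ᵐ x, x ∈ Icc T 1 →
      q x - κ = -Real.sign c * |√|k₁| * E x| ^ (2 * (p / (p - 1)) - 2) := by
    filter_upwards [hpot, hTne'] with x hx hxT hxI
    simpa only [if_neg (not_le.2 (lt_of_le_of_ne hxI.1 hxT.symm))] using
      hx ⟨hT.1.le.trans hxI.1, hxI.2⟩
  have hcne : c ≠ 0 := by
    have : 0 < A / D ^ 2 := by positivity
    exact div_ne_zero (mul_ne_zero hN1.ne' hk₀) this.ne'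
  refine ⟨c, hcne, fun c' => ⟨fun h => ?_, fun h => h ▸ hmult⟩, Real.sign c, rfl, ?_, ⟨?_, ?_⟩,
    ?_, ?_⟩
  -- Uniqueness needs a single point at which both equations hold and `E ≠ 0`, since `H` vanishes
  -- nowhere.
  · rw [IsMultiplier, ae_unitMeasure_iff] at h hmult
    have hvol : ∃ᵐ x, x ∈ Icc (0 : ℝ) 1 := by
      rw [frequently_ae_mem_iff]; simp
    obtain ⟨x, hxI, hx1, hx2, hx3⟩ :=
      (hvol.and_eventually (h.and (hmult.and (hE'.ae_ne_zero hqi)))).exists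
    have h1 : c' * stepH T E x * E x ^ 2 = c * stepH T E x * E x ^ 2 :=
      (hx1 hxI).symm.trans (hx2 hxI)
    have h2 : E x ^ 2 ≠ 0 := pow_ne_zero 2 (hx3 hxI).2
    have h3 : stepH T E x ≠ 0 := by
      intro h0
      have := hstep x
      rw [h0, mul_zero] at this
      split_ifs at this
      · exact mul_ne_zero hN1.ne' hk₀ this.symm
      · exact mul_ne_zero hN1.ne' hk₁ne this.symm
    exact mul_right_cancel₀ h3 (mul_right_cancel₀ h2 h1)
  · rw [CriticalPotential, ae_unitMeasure_iff]
    simpa only [hu] using hpot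
  · exact hE'.1.solvesOn hp le_rfl hT.1 hT.2.le hpot0 fun x hx => by rw [hu, if_pos hx.2]
  -- At `x = T` the definition of `u` takes the left branch; the two branches agree there because `E
  -- T = 0`.
  · refine hE'.1.solvesOn hp hT.1.le hT.2 le_rfl hpot1 fun x hx => ?_
    rw [hu]
    split_ifs with h
    · rw [le_antisymm h hx.1, hET, mul_zero, mul_zero]
    · rfl
  · rintro ⟨-, hlt⟩
    rcases Real.sign_apply_eq_of_ne_zero c hcne with h | h
    · exact h
    -- With `ε = 1` the potential is at least `κ` before `T` and at most `κ` after it, which pushes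
    -- the node to `T ≥ i / m`.
    · refine absurd (hq.2.1.div_le_of_le_of_le (κ := κ) hqi hi him ?_ ?_) (not_le.2 hlt)
      · filter_upwards [hpot0] with x hx hxI
        have h1 := hx (Ioo_subset_Icc_self hxI)
        rw [h, one_mul] at h1
        exact sub_nonneg.1 (h1 ▸ Real.rpow_nonneg (abs_nonneg _) _)
      · filter_upwards [hpot1] with x hx hxI
        have h1 := hx (Ioo_subset_Icc_self hxI)
        rw [h, neg_one_mul] at h1
        exact sub_nonpos.1 (h1 ▸ neg_nonpos.2 (Real.rpow_nonneg (abs_nonneg _) _))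
  · rintro ⟨hlt, -⟩
    rcases Real.sign_apply_eq_of_ne_zero c hcne with h | h
    · refine absurd (hq.2.1.le_div_of_le_of_le (κ := κ) hqi hi him ?_ ?_) (not_le.2 hlt)
      · filter_upwards [hpot0] with x hx hxI
        have h1 := hx (Ioo_subset_Icc_self hxI)
        rw [h, neg_one_mul] at h1
        exact sub_nonpos.1 (h1 ▸ neg_nonpos.2 (Real.rpow_nonneg (abs_nonneg _) _))
      · filter_upwards [hpot1] with x hx hxI
        have h1 := hx (Ioo_subset_Icc_self hxI)
        rw [h, neg_neg, one_mul] at h1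
        exact sub_nonneg.1 (h1 ▸ Real.rpow_nonneg (abs_nonneg _) _)
    · exact h
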